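/- **Setting (linear contextual bandits with knapsacks).** There are $K$ arms, $d\ge 1$ resources, a horizon $T$ and a budget $B>0$. Rounds $t=1,2,\dots$ produce tuples $(X_t,r_t,V_t)$ of law $\mathcal D$, each independent of all previous rounds, where column $x_t(a)\in[0,1]^m$ of $X_t\in[0,1]^{m\times K}$ is the context of arm $a$, $r_t(a)\in[0,1]$ its reward, and column $v_t(a)\in[0,1]^d$ of $V_t\in[0,1]^{d\times K}$ its consumption vector. There are unknown $\mu_*\in[0,1]^m$, $W_*\in[0,1]^{m\times d}$ with $\mathbb E[r_t(a)\mid X_t]=\mu_*^\top x_t(a)$ and $\mathbb E[v_t(a)\mid X_t]=W_*^\top x_t(a)$ for every arm $a$. A static policy $\pi$ maps each $X$ (measurably) to a probability distribution $\pi(X)$ on the $K$ arms plus a no-op with zero reward and zero consumption; in products such as $X\pi(X)$ the no-op contributes $0$. Let $$\mathrm{OPT}=\sup_\pi\{\,T\,\mathbb E[r^\top\pi(X)] : T\,\mathbb E[V\pi(X)]\le B\mathbf 1\}.$$ **Exploration.** Let $T_0\le T$. In round $t=1,\dots,T_0$, after observing $X_t$, choose $$p_t\in\arg\max_{p\in\Delta^{[K]}}\|X_tp\|_{M_t^{-1}},\qquad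 M_t=I+\sum_{i<t}(X_ip_i)(X_ip_i)^\top,\qquad \|v\|_{M}=\sqrt{v^\top M v},$$ (any choice depending only on the history and $X_t$), and play a random arm $a_t$ with distribution $p_t$. Put $$\hat\mu_t=M_t^{-1}\sum_{i<t}(X_ip_i)\,r_i(a_i),\qquad \hat W_t=M_t^{-1}\sum_{i<t}(X_ip_i)\,v_i(a_i)^\top,$$ $$\widehat{\mathrm{OPT}}^{\,\gamma}=\sup_\pi\Big\{\tfrac{T}{T_0}\sum_{i=1}^{T_0}\hat\mu_i^\top X_i\pi(X_i)\ :\ \tfrac{T}{T_0}\sum_{i=1}^{T_0}\hat W_i^\top X_i\pi(X_i)\le (B+\gamma)\mathbf 1\Big\}.$$ **Statement.** There is a universal constant $C>0$ such that the following holds for all such instances, all $T\ge T_0\ge\max\{2,m^2\}$, all $\delta\in(0,1)$, and every real $$\gamma\ \ge\ \frac{T}{T_0}\cdot 2m\sqrt{T_0\,\ln(T_0)\,\ln(T_0d/\delta)}$$ (in particular when equality holds). Set $Z=\dfrac{\widehat{\mathrm{OPT}}^{\,2\gamma}+2\gamma}{B}+1$. Then, with probability at least $1-C\delta$, $$\frac{\mathrm{OPT}}{B}+1\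 \le\ Z\ \le\ \Big(1+\frac{11\gamma}{B}\Big)\Big(\frac{\mathrm{OPT}}{B}+1\Big),$$ and, if moreover $B\ge\gamma$, then on the same event $Z\le 12\big(\frac{\mathrm{OPT}}{B}+1\big)$, so $Z$ is a constant-factor approximation of $\frac{\mathrm{OPT}}{B}+1$. -/

import Mathlib

open MeasureTheory
open scoped Matrix

noncomputable section

namespace LinCBwK

/-- Real matrices carry the product (equivalently, Borel) σ-algebra. -/
instance instMeasurableSpaceMatrix (m n : ℕ) : MeasurableSpace (Matrix (Fin m) (Fin n) ℝ) :=
  inferInstanceAs (MeasurableSpace (Fin m → Fin n → ℝ))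

/-- The contexts of all `K` arms: column `a` is the context vector of arm `a`. -/
abbrev Context (m K : ℕ) := Matrix (Fin m) (Fin K) ℝ

/-- What nature draws in one round: the contexts `X`, the rewards `r` of all arms, and the
consumption vectors of all arms (the columns of the `d × K` matrix `V`). -/
abbrev Outcome (m K d : ℕ) := Context m K × (Fin K → ℝ) × Matrix (Fin d) (Fin K) ℝ

variable {m K d : ℕ}

/-- The stochastic assumptions on the distribution `D` of the outcome of one round, with
parameters `μ` and `W`. Conditioning is on the contexts of all arms. -/
structure IsInstance (D : Measure (Outcome m K d)) (μ : Fin m → ℝ)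
    (W : Matrix (Fin m) (Fin d) ℝ) : Prop where
  prob : IsProbabilityMeasure D
  context_mem : ∀ᵐ y ∂D, ∀ l a, y.1 l a ∈ Set.Icc (0 : ℝ) 1
  reward_mem : ∀ᵐ y ∂D, ∀ a, y.2.1 a ∈ Set.Icc (0 : ℝ) 1
  consumption_mem : ∀ᵐ y ∂D, ∀ j a, y.2.2 j a ∈ Set.Icc (0 : ℝ) 1
  mu_mem : ∀ l, μ l ∈ Set.Icc (0 : ℝ) 1
  W_mem : ∀ l j, W l j ∈ Set.Icc (0 : ℝ) 1
  reward_linear : ∀ a,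
    D[fun y => y.2.1 a | MeasurableSpace.comap Prod.fst inferInstance]
      =ᵐ[D] fun y => (μ ᵥ* y.1) a
  consumption_linear : ∀ j a,
    D[fun y => y.2.2 j a | MeasurableSpace.comap Prod.fst inferInstance]
      =ᵐ[D] fun y => (Wᵀ * y.1) j a

/-- A static policy: a distribution over the `K` arms plus the no-op (`none`) for every context. -/
structure Policy (m K : ℕ) where
  toFun : Context m K → Option (Fin K) → ℝ
  measurable_toFun : Measurable toFun
  mem_simplex : ∀ X, toFun X ∈ stdSimplex ℝ (Option (Fin K))

/-- The probabilities of the `K` arms; the no-op yields no reward and no consumption. -/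
def Policy.arms (π : Policy m K) (X : Context m K) : Fin K → ℝ := fun a => π.toFun X (some a)

/-- Expected reward `r(π)` of a policy in one round. -/
def expReward (D : Measure (Outcome m K d)) (π : Policy m K) : ℝ :=
  ∫ y, y.2.1 ⬝ᵥ π.arms y.1 ∂D

/-- Expected consumption `v(π)` of a policy in one round. -/
def expConsumption (D : Measure (Outcome m K d)) (π : Policy m K) (j : Fin d) : ℝ :=
  ∫ y, (y.2.2 *ᵥ π.arms y.1) j ∂D

/-- The value of the optimal static policy. -/
def OPT (D : Measure (Outcome m K d)) (T : ℕ) (B : ℝ) : ℝ :=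
  sSup {v | ∃ π : Policy m K, (∀ j, T * expConsumption D π j ≤ B) ∧ v = T * expReward D π}

/-- The norm `‖v‖_M = √(vᵀ M v)`. -/
def mNorm (M : Matrix (Fin m) (Fin m) ℝ) (v : Fin m → ℝ) : ℝ := √(v ⬝ᵥ M *ᵥ v)

/-- `M_t = I + ∑_{i < t} (X_i p_i)(X_i p_i)ᵀ`; rounds are numbered from `0`. -/
def gram (X : ℕ → Context m K) (p : ℕ → Fin K → ℝ) (t : ℕ) : Matrix (Fin m) (Fin m) ℝ :=
  1 + ∑ i ∈ Finset.range t, Matrix.vecMulVec (X i *ᵥ p i) (X i *ᵥ p i)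

/-- The estimate of `μ` before round `t`, from the observed rewards `r`. -/
def muHat (X : ℕ → Context m K) (p : ℕ → Fin K → ℝ) (r : ℕ → ℝ) (t : ℕ) : Fin m → ℝ :=
  (gram X p t)⁻¹ *ᵥ ∑ i ∈ Finset.range t, r i • (X i *ᵥ p i)

/-- The estimate of `W` before round `t`, from the observed consumption vectors `v`. -/
def WHat (X : ℕ → Context m K) (p : ℕ → Fin K → ℝ) (v : ℕ → Fin d → ℝ) (t : ℕ) :
    Matrix (Fin m) (Fin d) ℝ :=
  (gram X p t)⁻¹ * ∑ i ∈ Finset.range t, Matrix.vecMulVec (X i *ᵥ p i) (v i)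

/-- The estimate of the optimum computed from the first `T₀` rounds, with every budget
constraint relaxed by `γ`. -/
def OPTHat (X : ℕ → Context m K) (p : ℕ → Fin K → ℝ) (r : ℕ → ℝ) (v : ℕ → Fin d → ℝ)
    (T T₀ : ℕ) (B γ : ℝ) : ℝ :=
  sSup {val | ∃ π : Policy m K,
    (∀ j, (T / T₀ : ℝ) * ∑ i ∈ Finset.range T₀,
      ((WHat X p v i)ᵀ *ᵥ (X i *ᵥ π.arms (X i))) j ≤ B + γ) ∧
    val = (T / T₀ : ℝ) * ∑ i ∈ Finset.range T₀, muHat X p r i ⬝ᵥ (X i *ᵥ π.arms (X i))}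

/-- The exploration procedure in rounds `t < T₀`. `Y t` is the outcome of round `t`, `p t` the
distribution over arms chosen in it, `A t` the arm drawn from `p t`, and `ℱ t` the history before
round `t`. -/
structure IsExploration {Ω : Type*} {mΩ : MeasurableSpace Ω} (P : Measure Ω)
    (D : Measure (Outcome m K d)) (T₀ : ℕ) (ℱ : Filtration ℕ mΩ)
    (Y : ℕ → Ω → Outcome m K d) (p : ℕ → Ω → Fin K → ℝ) (A : ℕ → Ω → Fin K) : Prop where
  outcome_adapted : ∀ t < T₀, Measurable[ℱ (t + 1)] (Y t)
  arm_adapted : ∀ t < T₀, Measurable[ℱ (t + 1)] (A t)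
  /-- The outcome of a round has law `D` and is independent of the previous rounds. -/
  outcome_law : ∀ t < T₀, P.map (Y t) = D
  outcome_indep : ∀ t < T₀, ProbabilityTheory.Indep (MeasurableSpace.comap (Y t) inferInstance) (ℱ t) P
  /-- The distribution `p t` is chosen from the history and the current contexts. -/
  choice_measurable : ∀ t < T₀,
    Measurable[ℱ t ⊔ MeasurableSpace.comap (fun ω => (Y t ω).1) inferInstance] (p t)
  /-- `p t` maximizes `‖X_t q‖_{M_t⁻¹}` over the probability distributions `q` on the arms. -/
  choice_mem : ∀ t < T₀, ∀ᵐ ω ∂P, p t ω ∈ stdSimplex ℝ (Fin K)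
  choice_max : ∀ t < T₀, ∀ᵐ ω ∂P, ∀ q ∈ stdSimplex ℝ (Fin K),
    mNorm (gram (fun i => (Y i ω).1) (fun i => p i ω) t)⁻¹ ((Y t ω).1 *ᵥ q) ≤
      mNorm (gram (fun i => (Y i ω).1) (fun i => p i ω) t)⁻¹ ((Y t ω).1 *ᵥ p t ω)
  /-- Given the history and the outcome of the round, arm `a` is selected with probability
  `p t a`. -/
  arm_law : ∀ t < T₀, ∀ a,
    P[fun ω => if A t ω = a then (1 : ℝ) else 0 |
      ℱ t ⊔ MeasurableSpace.comap (Y t) inferInstance] =ᵐ[P] fun ω => p t ω a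

/-- The estimate `Z = (OPTHat^{2γ} + 2γ) / B + 1`, computed from the contexts, the chosen
distributions and the observed rewards and consumptions of the arms played. -/
def Z {Ω : Type*} (Y : ℕ → Ω → Outcome m K d) (p : ℕ → Ω → Fin K → ℝ) (A : ℕ → Ω → Fin K)
    (T T₀ : ℕ) (B γ : ℝ) (ω : Ω) : ℝ :=
  (OPTHat (fun i => (Y i ω).1) (fun i => p i ω) (fun i => (Y i ω).2.1 (A i ω))
    (fun i j => (Y i ω).2.2 j (A i ω)) T T₀ B (2 * γ) + 2 * γ) / B + 1

end LinCBwK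

end

/-! Write `L = log (T₀ d / δ)`, `R = √(T₀ log T₀ · L)` and `κ = T / T₀`, so that `κ · 2mR ≤ γ`. The
plan is to make the regression error uniform over all policies by a pathwise argument. Sampling
error is then needed only for functions fixed in advance, where Hoeffding's inequality suffices.

Regression error. With `S` the noise sum, `muHat - θ = M⁻¹ (S - θ)`, so the error along a vector `x`
is at most `(‖S‖ + √m) ‖x‖` in the norm of `M⁻¹`. The explored distributions maximize `‖X q‖`, hence
no policy has a larger width than the one played. The process `exp (2 ‖S‖²) / √det M` has mean at
most `1`: one update of `M` is a rank-one formula, and the mean growth is controlled by writing it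
as a Gaussian integral of Hoeffding's lemma (`growth_mean_le`). Markov's inequality bounds `‖S‖`,
and the telescoping of `log det M` bounds the sum of the widths (`sum_sqrt_width_le`). The total
error is at most `3mR` for every policy at once (`sum_abs_muHat_sub_le`).

Lower bound on `Z`. A fixed nearly optimal policy has sampling error at most `mR` in reward and in
each consumption. Altogether `κ · 4mR ≤ 2γ`, so it stays feasible for the budget relaxed by `2γ` and
loses at most `2γ` of value.

Upper bound on `Z`. Hahn–Banach separation gives dual prices `c ≥ 0` for the true problem
(`exists_dual_prices`), with `∑ c ≤ OPT / B`. By weak duality on the sample, the estimated optimum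
is at most the empirical mean of one fixed function of the contexts, the best Lagrangian score, plus
the price of the relaxed budget and the errors. That score lies in `[0, 1]` almost surely, so
Hoeffding applies once more. -/

noncomputable section

namespace LinCBwK

variable {m K d : ℕ}

/-! ### The self-normalized one-step inequality -/

/-- Hoeffding's lemma for a Bernoulli variable. -/
theorem bernoulli_centered_mgf_le {q : ℝ} (hq0 : 0 ≤ q) (hq1 : q ≤ 1) (s : ℝ) :
    (1 - q) * Real.exp (-q * s) + q * Real.exp ((1 - q) * s) ≤ Real.exp (s ^ 2 / 8) := by
  set ν : Measure ℝ :=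
    ENNReal.ofReal (1 - q) • Measure.dirac 0 + ENNReal.ofReal q • Measure.dirac 1 with hν
  have hprob : IsProbabilityMeasure ν := by
    constructor
    simp only [hν, Measure.add_apply, Measure.smul_apply, measure_univ, smul_eq_mul, mul_one]
    rw [← ENNReal.ofReal_add (by linarith) hq0]
    simp
  have hint : ∀ f : ℝ → ℝ, ∫ x, f x ∂ν = (1 - q) * f 0 + q * f 1 := by
    intro f
    have h0 : Integrable f (ENNReal.ofReal (1 - q) • Measure.dirac 0) :=
      (integrable_dirac (by simp)).smul_measure ENNReal.ofReal_ne_top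
    have h1 : Integrable f (ENNReal.ofReal q • Measure.dirac 1) :=
      (integrable_dirac (by simp)).smul_measure ENNReal.ofReal_ne_top
    rw [hν, integral_add_measure h0 h1, integral_smul_measure, integral_smul_measure,
      integral_dirac, integral_dirac, ENNReal.toReal_ofReal (by linarith),
      ENNReal.toReal_ofReal hq0, smul_eq_mul, smul_eq_mul]
  have hae : ∀ᵐ x ∂ν, x ∈ Set.Icc (0 : ℝ) 1 := by
    rw [hν, ae_add_measure_iff]
    exact ⟨Measure.ae_smul_measure (by simp [ae_dirac_eq]) _,
      Measure.ae_smul_measure (by simp [ae_dirac_eq]) _⟩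
  have h := (ProbabilityTheory.hasSubgaussianMGF_of_mem_Icc (X := fun x : ℝ => x)
    aemeasurable_id hae).mgf_le s
  rw [ProbabilityTheory.mgf, hint, hint] at h
  have e : ((((‖(1 : ℝ) - 0‖₊ / 2) ^ 2 : NNReal) : ℝ)) * s ^ 2 / 2 = s ^ 2 / 8 := by
    simp; ring
  rw [e] at h
  refine le_trans (le_of_eq ?_) h
  congr 3 <;> ring_nf

theorem integrable_exp_quadratic {b : ℝ} (hb : 0 < b) (c e : ℝ) :
    Integrable fun x : ℝ => Real.exp (-b * x ^ 2 + c * x + e) := by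
  have h := ((integrable_exp_neg_mul_sq hb).comp_sub_right (c / (2 * b))).mul_const
    (Real.exp (e + c ^ 2 / (4 * b)))
  refine h.congr (ae_of_all _ fun x => ?_)
  simp only [← Real.exp_add]
  congr 1
  field_simp
  ring

theorem integral_exp_quadratic {b : ℝ} (hb : 0 < b) (c e : ℝ) :
    ∫ x : ℝ, Real.exp (-b * x ^ 2 + c * x + e)
      = √(Real.pi / b) * Real.exp (e + c ^ 2 / (4 * b)) := by
  have h : ∀ x : ℝ, Real.exp (-b * x ^ 2 + c * x + e)
      = Real.exp (-b * (x - c / (2 * b)) ^ 2) * Real.exp (e + c ^ 2 / (4 * b)) := by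
    intro x
    rw [← Real.exp_add]
    congr 1
    field_simp
    ring
  simp_rw [h, integral_mul_const]
  rw [integral_sub_right_eq_self (fun x : ℝ => Real.exp (-b * x ^ 2)), integral_gaussian]

/-- The factor by which the exponential self-normalized process grows when the noise is `x`. -/
def growth (u a x : ℝ) : ℝ := Real.exp (2 * ((2 * x * a + x ^ 2 * u - a ^ 2) / (1 + u)))

theorem growth_pos (u a x : ℝ) : 0 < growth u a x := Real.exp_pos _

/-- Completing the square. The noise `x` enters the integrand only through `exp (x * y)`, so a bound
on its moment generating function can be inserted under the integral: the method of mixtures. -/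
theorem integral_growth {u : ℝ} (hu : 0 < u) (a x : ℝ) :
    ∫ y : ℝ, Real.exp (-((1 + u) / (8 * u)) * y ^ 2 + (x + a / u) * y + -(2 * a ^ 2 / u))
      = √(8 * Real.pi * u) / √(1 + u) * growth u a x := by
  rw [integral_exp_quadratic (by positivity), growth, ← Real.sqrt_div' _ (by positivity)]
  congr 2
  · field_simp
  · field_simp
    ring

/-- The factor `√(1 + u)` is exactly the growth of `√det M` in one round, so this is the
supermartingale property. The `2` in the exponent of `growth` is matched to the variance proxy `1/4`
of a `[0, 1]`-valued variable. -/
theorem growth_mean_le {q u : ℝ} (hq0 : 0 ≤ q) (hq1 : q ≤ 1) (hu : 0 ≤ u) (a : ℝ) :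
    (1 - q) * growth u a (-q) + q * growth u a (1 - q) ≤ √(1 + u) := by
  -- At `u = 0` the Gaussian weight degenerates, and Hoeffding's lemma at `4 * a` gives the bound
  -- directly.
  rcases hu.eq_or_lt with rfl | hu
  · have h := mul_le_mul_of_nonneg_right (bernoulli_centered_mgf_le hq0 hq1 (4 * a))
      (Real.exp_pos (-(2 * a ^ 2))).le
    have e : ∀ x, growth 0 a x = Real.exp (x * (4 * a)) * Real.exp (-(2 * a ^ 2)) := by
      intro x
      rw [growth, ← Real.exp_add]
      congr 1
      ring
    rw [← Real.exp_add] at h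
    rw [e, e]
    calc _ = ((1 - q) * Real.exp (-q * (4 * a)) + q * Real.exp ((1 - q) * (4 * a)))
          * Real.exp (-(2 * a ^ 2)) := by ring
      _ ≤ _ := h
      _ = _ := by
        rw [show (4 * a) ^ 2 / 8 + -(2 * a ^ 2) = 0 by ring]
        simp
  · set φ : ℝ → ℝ → ℝ := fun x y =>
      Real.exp (-((1 + u) / (8 * u)) * y ^ 2 + (x + a / u) * y + -(2 * a ^ 2 / u)) with hφ
    have hi : ∀ x, Integrable (φ x) := fun x => integrable_exp_quadratic (by positivity) _ _
    have hb : (0 : ℝ) < 1 / (8 * u) := by positivity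
    -- Hoeffding's lemma at each `y` adds `y ^ 2 / 8` to the exponent, which turns the coefficient
    -- `(1 + u) / (8 * u)` into `1 / (8 * u)`. The remaining Gaussian integral no longer depends on
    -- `a`.
    have hle : ∫ y, ((1 - q) * φ (-q) y + q * φ (1 - q) y)
        ≤ ∫ y : ℝ, Real.exp (-(1 / (8 * u)) * y ^ 2 + a / u * y + -(2 * a ^ 2 / u)) := by
      refine integral_mono (((hi _).const_mul _).add ((hi _).const_mul _))
        (integrable_exp_quadratic hb _ _) fun y => ?_
      set w := Real.exp (-((1 + u) / (8 * u)) * y ^ 2 + a / u * y + -(2 * a ^ 2 / u)) with hw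
      have hφw : ∀ x, φ x y = Real.exp (x * y) * w := by
        intro x
        simp only [hφ, hw]
        rw [← Real.exp_add]
        congr 1
        ring
      have hr : Real.exp (-(1 / (8 * u)) * y ^ 2 + a / u * y + -(2 * a ^ 2 / u))
          = Real.exp (y ^ 2 / 8) * w := by
        rw [hw, ← Real.exp_add]
        congr 1
        field_simp
        ring
      have h := mul_le_mul_of_nonneg_right (bernoulli_centered_mgf_le hq0 hq1 y)
        (Real.exp_pos (-((1 + u) / (8 * u)) * y ^ 2 + a / u * y + -(2 * a ^ 2 / u))).le
      rw [← hw] at h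
      simp only
      rw [hφw, hφw, hr]
      linarith
    rw [integral_add ((hi _).const_mul _) ((hi _).const_mul _), integral_const_mul,
      integral_const_mul, integral_growth hu, integral_growth hu, integral_exp_quadratic hb] at hle
    have e1 : -(2 * a ^ 2 / u) + (a / u) ^ 2 / (4 * (1 / (8 * u))) = 0 := by
      field_simp
      ring
    have e2 : Real.pi / (1 / (8 * u)) = 8 * Real.pi * u := by field_simp
    rw [e1, e2, Real.exp_zero, mul_one] at hle
    have hs : 0 < √(8 * Real.pi * u) := Real.sqrt_pos.2 (by positivity)
    have ht : 0 < √(1 + u) := Real.sqrt_pos.2 (by positivity)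
    have h3 : √(8 * Real.pi * u) / √(1 + u) *
        ((1 - q) * growth u a (-q) + q * growth u a (1 - q)) ≤ √(8 * Real.pi * u) := by
      linarith
    rw [div_mul_eq_mul_div, div_le_iff₀ ht] at h3
    exact le_of_mul_le_mul_left h3 hs

theorem convexOn_growth {u : ℝ} (hu : 0 ≤ u) (a : ℝ) : ConvexOn ℝ Set.univ (growth u a) := by
  have hq : ConvexOn ℝ Set.univ
      (fun x : ℝ => 2 * ((2 * x * a + x ^ 2 * u - a ^ 2) / (1 + u))) := by
    refine ⟨convex_univ, fun x _ y _ s t hs ht hst => ?_⟩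
    simp only [smul_eq_mul]
    obtain rfl : t = 1 - s := by linarith
    have h : s * (2 * ((2 * x * a + x ^ 2 * u - a ^ 2) / (1 + u))) +
        (1 - s) * (2 * ((2 * y * a + y ^ 2 * u - a ^ 2) / (1 + u))) -
        2 * ((2 * (s * x + (1 - s) * y) * a + (s * x + (1 - s) * y) ^ 2 * u - a ^ 2) / (1 + u))
        = 2 * (s * (1 - s) * (x - y) ^ 2 * u / (1 + u)) := by
      field_simp
      ring
    have : 0 ≤ 2 * (s * (1 - s) * (x - y) ^ 2 * u / (1 + u)) := by positivity
    linarith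
  exact ⟨convex_univ, fun x hx y hy s t hs ht hst =>
    (Real.exp_le_exp.2 (hq.2 hx hy hs ht hst)).trans
      (convexOn_exp.2 (Set.mem_univ _) (Set.mem_univ _) hs ht hst)⟩

/-- Convexity reduces a `[0, 1]`-valued observation to a Bernoulli variable with the same mean. -/
theorem growth_le_chord {u : ℝ} (hu : 0 ≤ u) (a q : ℝ) {r : ℝ} (hr0 : 0 ≤ r) (hr1 : r ≤ 1) :
    growth u a (r - q) ≤ (1 - r) * growth u a (-q) + r * growth u a (1 - q) := by
  have h := (convexOn_growth hu a).2 (Set.mem_univ (-q)) (Set.mem_univ (1 - q))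
    (sub_nonneg.2 hr1) hr0 (by ring)
  simp only [smul_eq_mul] at h
  rwa [show (1 - r) * -q + r * (1 - q) = r - q by ring] at h

/-! ### Rank-one updates of positive definite matrices -/

section Matrices

variable {M : Matrix (Fin m) (Fin m) ℝ}

theorem dotProduct_mulVec_comm (hM : M.IsHermitian) (x y : Fin m → ℝ) :
    x ⬝ᵥ M *ᵥ y = y ⬝ᵥ M *ᵥ x := by
  have h : Mᵀ = M := (Matrix.conjTranspose_eq_transpose_of_trivial M).symm.trans hM.eq
  rw [Matrix.dotProduct_mulVec, dotProduct_comm, ← Matrix.mulVec_transpose, h]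

theorem quadForm_nonneg (hM : M.PosSemidef) (x : Fin m → ℝ) : 0 ≤ x ⬝ᵥ M *ᵥ x := by
  simpa using hM.dotProduct_mulVec_nonneg x

theorem quadForm_add (hM : M.IsHermitian) (x y : Fin m → ℝ) :
    (x + y) ⬝ᵥ M *ᵥ (x + y) = x ⬝ᵥ M *ᵥ x + 2 * (x ⬝ᵥ M *ᵥ y) + y ⬝ᵥ M *ᵥ y := by
  rw [Matrix.mulVec_add, add_dotProduct, dotProduct_add, dotProduct_add,
    dotProduct_mulVec_comm hM y x]
  ring

theorem abs_dotProduct_mulVec_le (hM : M.PosSemidef) (x y : Fin m → ℝ) :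
    |x ⬝ᵥ M *ᵥ y| ≤ mNorm M x * mNorm M y := by
  have h : discrim (y ⬝ᵥ M *ᵥ y) (2 * (x ⬝ᵥ M *ᵥ y)) (x ⬝ᵥ M *ᵥ x) ≤ 0 := by
    refine discrim_le_zero fun t => ?_
    have h := quadForm_nonneg hM (x + t • y)
    rw [quadForm_add hM.1, Matrix.mulVec_smul, dotProduct_smul, smul_dotProduct,
      dotProduct_smul] at h
    simp only [smul_eq_mul] at h
    nlinarith
  rw [discrim] at h
  rw [mNorm, mNorm, ← Real.sqrt_mul (quadForm_nonneg hM x)]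
  exact Real.abs_le_sqrt (by nlinarith)

theorem mNorm_nonneg (M : Matrix (Fin m) (Fin m) ℝ) (x : Fin m → ℝ) : 0 ≤ mNorm M x :=
  Real.sqrt_nonneg _

theorem sq_mNorm (hM : M.PosSemidef) (x : Fin m → ℝ) : mNorm M x ^ 2 = x ⬝ᵥ M *ᵥ x :=
  Real.sq_sqrt (quadForm_nonneg hM x)

theorem mNorm_add_le (hM : M.PosSemidef) (x y : Fin m → ℝ) :
    mNorm M (x + y) ≤ mNorm M x + mNorm M y := by
  refine le_of_sq_le_sq ?_ (add_nonneg (mNorm_nonneg _ _) (mNorm_nonneg _ _))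
  rw [add_sq, sq_mNorm hM, sq_mNorm hM, sq_mNorm hM, quadForm_add hM.1]
  have := (le_abs_self _).trans (abs_dotProduct_mulVec_le hM x y)
  linarith

theorem mNorm_smul (M : Matrix (Fin m) (Fin m) ℝ) (c : ℝ) (x : Fin m → ℝ) :
    mNorm M (c • x) = |c| * mNorm M x := by
  rw [mNorm, mNorm, Matrix.mulVec_smul, dotProduct_smul, smul_dotProduct, smul_eq_mul,
    smul_eq_mul, ← mul_assoc, ← sq, Real.sqrt_mul (sq_nonneg c), Real.sqrt_sq_eq_abs]

theorem mNorm_neg (M : Matrix (Fin m) (Fin m) ℝ) (x : Fin m → ℝ) : mNorm M (-x) = mNorm M x := by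
  simpa using mNorm_smul M (-1) x

theorem vecMulVec_self_posSemidef (v : Fin m → ℝ) : (Matrix.vecMulVec v v).PosSemidef := by
  simpa using Matrix.posSemidef_vecMulVec_self_star v

theorem vecMulVec_self_mulVec (v y : Fin m → ℝ) :
    Matrix.vecMulVec v v *ᵥ y = (v ⬝ᵥ y) • v := by
  rw [Matrix.vecMulVec_mulVec]
  ext i
  simp [mul_comm]

theorem det_add_vecMulVec_self (hM : M.PosDef) (v : Fin m → ℝ) :
    (M + Matrix.vecMulVec v v).det = M.det * (1 + v ⬝ᵥ M⁻¹ *ᵥ v) := by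
  have h := Matrix.det_add_replicateCol_mul_replicateRow (ι := Unit) (A := M)
    ((Matrix.isUnit_iff_isUnit_det _).1 hM.isUnit) v v
  rw [← Matrix.vecMulVec_eq] at h
  rw [h, Matrix.mul_assoc, Matrix.det_unique (n := Unit)]
  congr 1

theorem mulVec_inv_mulVec (hM : M.PosDef) (x : Fin m → ℝ) : M *ᵥ M⁻¹ *ᵥ x = x := by
  rw [Matrix.mulVec_mulVec,
    Matrix.mul_nonsing_inv _ ((Matrix.isUnit_iff_isUnit_det _).1 hM.isUnit), Matrix.one_mulVec]

theorem inv_mulVec_mulVec (hM : M.PosDef) (x : Fin m → ℝ) : M⁻¹ *ᵥ M *ᵥ x = x := by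
  rw [Matrix.mulVec_mulVec,
    Matrix.nonsing_inv_mul _ ((Matrix.isUnit_iff_isUnit_det _).1 hM.isUnit), Matrix.one_mulVec]

/-- The Sherman–Morrison formula, checked by multiplying the claimed solution by the updated matrix.
Twice the increment is the exponent of `growth`. -/
theorem quadForm_inv_update (hM : M.PosDef) (v S : Fin m → ℝ) (x : ℝ) :
    (S + x • v) ⬝ᵥ (M + Matrix.vecMulVec v v)⁻¹ *ᵥ (S + x • v) =
      S ⬝ᵥ M⁻¹ *ᵥ S + (2 * x * (v ⬝ᵥ M⁻¹ *ᵥ S) + x ^ 2 * (v ⬝ᵥ M⁻¹ *ᵥ v)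
        - (v ⬝ᵥ M⁻¹ *ᵥ S) ^ 2) / (1 + v ⬝ᵥ M⁻¹ *ᵥ v) := by
  have hN : (M + Matrix.vecMulVec v v).PosDef := hM.add_posSemidef (vecMulVec_self_posSemidef v)
  set u := v ⬝ᵥ M⁻¹ *ᵥ v with hu
  set a := v ⬝ᵥ M⁻¹ *ᵥ S with ha
  have hu0 : 0 ≤ u := quadForm_nonneg hM.inv.posSemidef v
  have hu1 : 1 + u ≠ 0 := by positivity
  have key : (M + Matrix.vecMulVec v v)⁻¹ *ᵥ (S + x • v)
      = M⁻¹ *ᵥ S + (x - (a + x * u) / (1 + u)) • M⁻¹ *ᵥ v := by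
    have h : (M + Matrix.vecMulVec v v) *ᵥ
        (M⁻¹ *ᵥ S + (x - (a + x * u) / (1 + u)) • M⁻¹ *ᵥ v) = S + x • v := by
      rw [Matrix.add_mulVec, vecMulVec_self_mulVec, Matrix.mulVec_add, Matrix.mulVec_smul,
        mulVec_inv_mulVec hM, mulVec_inv_mulVec hM, dotProduct_add, dotProduct_smul, ← ha, ← hu,
        add_assoc, ← add_smul, smul_eq_mul]
      congr 2
      field_simp
      ring
    rw [← h, inv_mulVec_mulVec hN]
  have hS : S ⬝ᵥ M⁻¹ *ᵥ v = a := dotProduct_mulVec_comm hM.inv.1 S v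
  rw [key, add_dotProduct, smul_dotProduct, dotProduct_add, dotProduct_add, dotProduct_smul,
    dotProduct_smul, hS, ← ha, ← hu]
  simp only [smul_eq_mul]
  field_simp
  ring

/-- With `y = (1 + P)⁻¹ x` one has `x = y + P y`, and both sides expand into nonnegative terms. -/
theorem quadForm_inv_one_add_le {P : Matrix (Fin m) (Fin m) ℝ} (hP : P.PosSemidef)
    (x : Fin m → ℝ) : x ⬝ᵥ (1 + P)⁻¹ *ᵥ x ≤ x ⬝ᵥ x := by
  have hM : (1 + P).PosDef := Matrix.PosDef.one.add_posSemidef hP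
  set y := (1 + P)⁻¹ *ᵥ x with hy
  have hx : x = y + P *ᵥ y := by
    have := mulVec_inv_mulVec hM x
    rw [← hy, Matrix.add_mulVec, Matrix.one_mulVec] at this
    exact this.symm
  have h1 := quadForm_nonneg hP y
  have h2 : 0 ≤ (P *ᵥ y) ⬝ᵥ (P *ᵥ y) := Finset.sum_nonneg fun i _ => mul_self_nonneg _
  have h3 : (P *ᵥ y) ⬝ᵥ y = y ⬝ᵥ P *ᵥ y := dotProduct_comm _ _
  rw [hx, add_dotProduct, add_dotProduct, dotProduct_add, dotProduct_add, h3]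
  linarith

/-- The arithmetic–geometric mean inequality for the eigenvalues, from `λ ≤ c * exp (λ / c - 1)` for
each of them. -/
theorem det_le_pow_of_trace_le (hM : M.PosDef) {c : ℝ} (hc : 0 < c) (h : M.trace ≤ m * c) :
    M.det ≤ c ^ m := by
  have hdet : M.det = ∏ i, hM.1.eigenvalues i := by simpa using hM.1.det_eq_prod_eigenvalues
  have htr : M.trace = ∑ i, hM.1.eigenvalues i := by simpa using hM.1.trace_eq_sum_eigenvalues
  calc M.det = ∏ i, hM.1.eigenvalues i := hdet
    _ ≤ ∏ i, c * Real.exp (hM.1.eigenvalues i / c - 1) := by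
        refine Finset.prod_le_prod (fun i _ => (hM.eigenvalues_pos i).le) fun i _ => ?_
        have := Real.add_one_le_exp (hM.1.eigenvalues i / c - 1)
        calc hM.1.eigenvalues i = c * (hM.1.eigenvalues i / c - 1 + 1) := by field_simp; ring
          _ ≤ _ := by gcongr
    _ = c ^ m * Real.exp (M.trace / c - m) := by
        rw [Finset.prod_mul_distrib, ← Real.exp_sum, Finset.sum_sub_distrib, ← Finset.sum_div, htr]
        simp
    _ ≤ c ^ m * 1 := by
        gcongr
        rw [Real.exp_le_one_iff, sub_nonpos, div_le_iff₀ hc]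
        exact h
    _ = c ^ m := mul_one _

end Matrices

/-! ### The regularized Gram matrix, its determinant and the widths -/

section Gram

variable (X : ℕ → Context m K) (p : ℕ → Fin K → ℝ)

theorem gram_zero : gram X p 0 = 1 := by simp [gram]

theorem gram_succ (t : ℕ) :
    gram X p (t + 1) = gram X p t + Matrix.vecMulVec (X t *ᵥ p t) (X t *ᵥ p t) := by
  rw [gram, gram, Finset.sum_range_succ, add_assoc]

theorem gram_sum_posSemidef (t : ℕ) :
    (∑ i ∈ Finset.range t, Matrix.vecMulVec (X i *ᵥ p i) (X i *ᵥ p i)).PosSemidef :=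
  Matrix.posSemidef_sum _ fun _ _ => vecMulVec_self_posSemidef _

theorem gram_posDef (t : ℕ) : (gram X p t).PosDef :=
  Matrix.PosDef.one.add_posSemidef (gram_sum_posSemidef X p t)

theorem gram_inv_posSemidef (t : ℕ) : (gram X p t)⁻¹.PosSemidef :=
  (gram_posDef X p t).inv.posSemidef

theorem quadForm_gram_inv_le (t : ℕ) (x : Fin m → ℝ) : x ⬝ᵥ (gram X p t)⁻¹ *ᵥ x ≤ x ⬝ᵥ x :=
  quadForm_inv_one_add_le (gram_sum_posSemidef X p t) x

/-- The squared width `‖X_t p_t‖²` in the norm of `M_t⁻¹`. -/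
def width (t : ℕ) : ℝ := (X t *ᵥ p t) ⬝ᵥ (gram X p t)⁻¹ *ᵥ (X t *ᵥ p t)

theorem width_nonneg (t : ℕ) : 0 ≤ width X p t := quadForm_nonneg (gram_inv_posSemidef X p t) _

theorem det_gram_succ (t : ℕ) : (gram X p (t + 1)).det = (gram X p t).det * (1 + width X p t) := by
  rw [gram_succ, det_add_vecMulVec_self (gram_posDef X p t), width]

theorem sum_log_width (t : ℕ) :
    ∑ i ∈ Finset.range t, Real.log (1 + width X p i) = Real.log (gram X p t).det := by
  induction t with
  | zero => simp [gram_zero]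
  | succ t ih =>
    rw [Finset.sum_range_succ, ih, det_gram_succ,
      Real.log_mul (gram_posDef X p t).det_pos.ne' (by linarith [width_nonneg X p t])]

theorem dotProduct_self_le {x : Fin m → ℝ} (hx : ∀ l, x l ∈ Set.Icc (0 : ℝ) 1) : x ⬝ᵥ x ≤ m := by
  calc x ⬝ᵥ x ≤ ∑ _l : Fin m, (1 : ℝ) :=
        Finset.sum_le_sum fun l _ => mul_le_one₀ (hx l).2 (hx l).1 (hx l).2
    _ = m := by simp

variable {X p}

theorem log_det_gram_le {t : ℕ}
    (h : ∀ i < t, ∀ l, (X i *ᵥ p i) l ∈ Set.Icc (0 : ℝ) 1) :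
    Real.log (gram X p t).det ≤ m * Real.log (1 + t) := by
  rw [← Real.log_pow]
  refine Real.log_le_log (gram_posDef X p t).det_pos
    (det_le_pow_of_trace_le (gram_posDef X p t) (by positivity) ?_)
  rw [gram, Matrix.trace_add, Matrix.trace_one, Matrix.trace_sum, Fintype.card_fin]
  calc (m : ℝ) + ∑ i ∈ Finset.range t, (Matrix.vecMulVec (X i *ᵥ p i) (X i *ᵥ p i)).trace
      ≤ m + ∑ _i ∈ Finset.range t, (m : ℝ) := by
        gcongr with i hi
        rw [Matrix.trace_vecMulVec]
        exact dotProduct_self_le (h i (Finset.mem_range.1 hi))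
    _ = m * (1 + t) := by simp; ring

theorem width_le {t : ℕ} (h : ∀ l, (X t *ᵥ p t) l ∈ Set.Icc (0 : ℝ) 1) : width X p t ≤ m :=
  (quadForm_gram_inv_le X p t _).trans (dotProduct_self_le h)

end Gram

/-! ### The elliptical potential -/

theorem log_one_add_le {x : ℝ} (hx : 2 ≤ x) : Real.log (1 + x) ≤ 1.6 * Real.log x := by
  have h1 : Real.log (1 + x) ≤ Real.log (3 / 2) + Real.log x := by
    rw [← Real.log_mul (by norm_num) (by linarith)]
    exact Real.log_le_log (by linarith) (by linarith)
  -- Since `(3/2)^5 ≤ 2^3`, the extra `log (3/2)` is at most `0.6 * log 2`; this is the source of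
  -- `1.6`.
  have h2 : 5 * Real.log (3 / 2) ≤ 3 * Real.log 2 := by
    have := Real.log_le_log (x := (3 / 2 : ℝ) ^ 5) (y := 2 ^ 3) (by norm_num) (by norm_num)
    rwa [Real.log_pow, Real.log_pow] at this
  have h3 : Real.log 2 ≤ Real.log x := Real.log_le_log (by norm_num) hx
  linarith

theorem mul_log_two_le_log_one_add {u : ℝ} (h0 : 0 ≤ u) (h1 : u ≤ 1) :
    u * Real.log 2 ≤ Real.log (1 + u) := by
  have h := strictConcaveOn_log_Ioi.concaveOn.2 (Set.mem_Ioi.2 one_pos)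
    (Set.mem_Ioi.2 two_pos) (sub_nonneg.2 h1) h0 (by ring)
  simp only [smul_eq_mul, Real.log_one, mul_zero, zero_add, mul_one] at h
  rwa [show 1 - u + u * 2 = 1 + u by ring] at h

theorem mul_log_le_mul_sq_log_one_add {u x : ℝ} (hu : 1 ≤ u) (hx : u ≤ x) :
    u * Real.log x ≤ 1.125 * (x * Real.log (1 + u) ^ 2) := by
  have he := Real.exp_one_gt_d9
  have hx0 : 0 < x := by linarith
  have hu0 : 0 < u := by linarith
  -- The function `log x / x` peaks at `e`: below it the bound `1 / e` serves, above it the value at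
  -- `u`.
  rcases le_total u (Real.exp 1) with h | h
  · have h1 : Real.log x ≤ x / Real.exp 1 := by
      have := Real.log_le_sub_one_of_pos (div_pos hx0 (Real.exp_pos 1))
      rw [Real.log_div hx0.ne' (Real.exp_pos 1).ne', Real.log_exp] at this
      linarith
    have h2 : u / Real.exp 1 ≤ 1.125 * Real.log (1 + u) ^ 2 := by
      have h3 := Real.le_log_one_add_of_nonneg hu0.le
      have h4 : u / Real.exp 1 ≤ 1.125 * (2 * u / (u + 2)) ^ 2 := by
        have he' := Real.exp_one_lt_d9
        rw [div_pow, ← mul_div_assoc, div_le_div_iff₀ (by positivity) (by positivity)]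
        have h5 : (u + 2) ^ 2 ≤ 4.5 * u * Real.exp 1 := by nlinarith
        nlinarith
      refine h4.trans ?_
      gcongr
    calc u * Real.log x ≤ u * (x / Real.exp 1) := by gcongr
      _ = x * (u / Real.exp 1) := by ring
      _ ≤ x * (1.125 * Real.log (1 + u) ^ 2) := by gcongr
      _ = _ := by ring
  · have hl : 1 ≤ Real.log u := by
      rw [Real.le_log_iff_exp_le hu0]
      exact h
    have h1 : Real.log x ≤ x / u - 1 + Real.log u := by
      have := Real.log_le_sub_one_of_pos (div_pos hx0 hu0)
      rw [Real.log_div hx0.ne' hu0.ne'] at this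
      linarith
    have h2 : 1 ≤ x / u := (one_le_div hu0).2 hx
    have h3 : Real.log x ≤ x / u * Real.log u := by nlinarith
    have h4 : Real.log u ≤ Real.log (1 + u) := Real.log_le_log hu0 (by linarith)
    calc u * Real.log x ≤ u * (x / u * Real.log u) := by gcongr
      _ = x * Real.log u := by field_simp
      _ ≤ x * Real.log (1 + u) ^ 2 := by
          gcongr
          nlinarith
      _ ≤ _ := by
          have : 0 ≤ x * Real.log (1 + u) ^ 2 := by positivity
          linarith

/-- Up to a constant, `ρ` is the target average of `√u`. For `u ≤ 1` this is the inequality of means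
together with `u * log 2 ≤ log (1 + u)`. For larger `u` the logarithmic term suffices, thanks to `u
≤ n ≤ √N`. -/
theorem sqrt_le_add_mul_log {n N u ρ : ℝ} (hN : 2 ≤ N) (hnN : n ^ 2 ≤ N)
    (hρ0 : 0 < ρ) (hρ : ρ ^ 2 * N = n * Real.log N) (hu0 : 0 ≤ u) (hu : u ≤ n) :
    √u ≤ 0.2405 * ρ + 1.5 / ρ * Real.log (1 + u) := by
  have hl2 := Real.log_two_gt_d9
  rcases le_total u 1 with h | h
  · have h1 := mul_log_two_le_log_one_add hu0 h
    set w := √u with hw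
    have hwu : w ^ 2 = u := Real.sq_sqrt hu0
    have h2 : w ≤ 0.2405 * ρ + 1.5 / ρ * (u * Real.log 2) := by
      -- A quadratic inequality in `w` and `ρ`; its discriminant condition `4 * 0.2405 * 1.5 * log 2
      -- ≥ 1` holds narrowly, with near-equality at `w = 0.481 * ρ`.
      rw [div_mul_eq_mul_div, ← sub_le_iff_le_add', le_div_iff₀ hρ0, ← hwu]
      have : (0.6931471803 : ℝ) * w ^ 2 ≤ w ^ 2 * Real.log 2 := by nlinarith [sq_nonneg w]
      nlinarith [sq_nonneg (w - 0.481 * ρ)]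
    refine h2.trans ?_
    gcongr
  · have hx : n ≤ √N := Real.le_sqrt_of_sq_le hnN
    have h1 := mul_log_le_mul_sq_log_one_add h (hu.trans hx)
    rw [Real.log_sqrt (by linarith)] at h1
    have hlN : 0 < Real.log N := Real.log_pos (by linarith)
    have hsN : √N * √N = N := Real.mul_self_sqrt (by linarith)
    have hs0 : 0 < √N := Real.sqrt_pos.2 (by linarith)
    have h2 : u * (n * Real.log N) ≤ 2.25 * (N * Real.log (1 + u) ^ 2) := by
      calc u * (n * Real.log N) ≤ u * (√N * Real.log N) := by gcongr
        _ = 2 * √N * (u * (Real.log N / 2)) := by ring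
        _ ≤ 2 * √N * (1.125 * (√N * Real.log (1 + u) ^ 2)) := by gcongr
        _ = 2.25 * (√N * √N * Real.log (1 + u) ^ 2) := by ring
        _ = _ := by rw [hsN]
    have hl0 : 0 ≤ Real.log (1 + u) := Real.log_nonneg (by linarith)
    have h3 : √u ≤ 1.5 / ρ * Real.log (1 + u) := by
      refine Real.sqrt_le_iff.2 ⟨by positivity, ?_⟩
      rw [mul_pow, div_pow, div_mul_eq_mul_div, le_div_iff₀ (by positivity)]
      have h4 : N * (u * ρ ^ 2) ≤ N * (1.5 ^ 2 * Real.log (1 + u) ^ 2) := by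
        rw [← hρ] at h2
        linarith
      exact le_of_mul_le_mul_left h4 (by linarith)
    have : 0 ≤ 0.2405 * ρ := by positivity
    linarith

/-- A width may be as large as `m`, so `u ≤ C * log (1 + u)` is not available with a universal
constant. Bounding `√u` affinely in `log (1 + u)` still lets the logarithms telescope to `log det
M`, and `m ^ 2 ≤ N` absorbs the large widths. The constant is `0.2405 + 1.5 * 1.6`. -/
theorem sum_sqrt_width_le {X : ℕ → Context m K} {p : ℕ → Fin K → ℝ} {N : ℕ} (hN : 2 ≤ N)
    (hm : 1 ≤ m) (hmN : m ^ 2 ≤ N)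
    (h : ∀ i < N, ∀ l, (X i *ᵥ p i) l ∈ Set.Icc (0 : ℝ) 1) :
    ∑ i ∈ Finset.range N, √(width X p i) ≤ 2.6405 * √(N * (m * Real.log N)) := by
  have hN' : (2 : ℝ) ≤ N := by exact_mod_cast hN
  have hm' : (1 : ℝ) ≤ m := by exact_mod_cast hm
  have hlN : 0 < Real.log N := Real.log_pos (by linarith)
  set ρ := √(m * Real.log N / N) with hρ
  have hρ0 : 0 < ρ := Real.sqrt_pos.2 (by positivity)
  have hρ2 : ρ ^ 2 * N = m * Real.log N := by
    rw [hρ, Real.sq_sqrt (by positivity)]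
    field_simp
  have hΛ : √(N * (m * Real.log N)) = N * ρ := by
    rw [← hρ2, show (N : ℝ) * (ρ ^ 2 * N) = (N * ρ) ^ 2 by ring, Real.sqrt_sq (by positivity)]
  calc ∑ i ∈ Finset.range N, √(width X p i)
      ≤ ∑ i ∈ Finset.range N, (0.2405 * ρ + 1.5 / ρ * Real.log (1 + width X p i)) := by
        refine Finset.sum_le_sum fun i hi => sqrt_le_add_mul_log hN' (by exact_mod_cast hmN)
          hρ0 hρ2 (width_nonneg X p i) (width_le (h i (Finset.mem_range.1 hi)))
    _ = 0.2405 * (N * ρ) + 1.5 / ρ * Real.log (gram X p N).det := by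
        rw [Finset.sum_add_distrib, ← sum_log_width, Finset.mul_sum]
        simp
        ring
    _ ≤ 0.2405 * (N * ρ) + 1.5 / ρ * (m * (1.6 * Real.log N)) := by
        gcongr
        exact (log_det_gram_le h).trans (by gcongr; exact log_one_add_le hN')
    _ = 0.2405 * (N * ρ) + 1.5 / ρ * (1.6 * (ρ ^ 2 * N)) := by rw [hρ2]; ring
    _ = 2.6405 * √(N * (m * Real.log N)) := by
        rw [hΛ]
        field_simp
        ring

/-! ### Deterministic error bounds for the least-squares estimate -/

section Estimate

variable (X : ℕ → Context m K) (p : ℕ → Fin K → ℝ) (θ : Fin m → ℝ) (r : ℕ → ℝ)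

/-- The noise `∑_{i < t} (r_i - θᵀ X_i p_i) X_i p_i` in the least-squares estimate of `θ`. -/
def noiseSum (t : ℕ) : Fin m → ℝ :=
  ∑ i ∈ Finset.range t, (r i - θ ⬝ᵥ (X i *ᵥ p i)) • (X i *ᵥ p i)

/-- The self-normalized exponential process. -/
def selfNormExp (t : ℕ) : ℝ :=
  Real.exp (2 * (noiseSum X p θ r t ⬝ᵥ (gram X p t)⁻¹ *ᵥ noiseSum X p θ r t)) /
    √(gram X p t).det

/-- The inner product of the new direction with the noise, in the norm of `M_t⁻¹`. -/
def noiseCorr (t : ℕ) : ℝ := (X t *ᵥ p t) ⬝ᵥ (gram X p t)⁻¹ *ᵥ noiseSum X p θ r t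

theorem selfNormExp_nonneg (t : ℕ) : 0 ≤ selfNormExp X p θ r t := by
  unfold selfNormExp
  positivity

theorem selfNormExp_zero : selfNormExp X p θ r 0 = 1 := by
  simp [selfNormExp, noiseSum, gram_zero]

theorem selfNormExp_succ (t : ℕ) :
    selfNormExp X p θ r (t + 1) = selfNormExp X p θ r t / √(1 + width X p t) *
      growth (width X p t) (noiseCorr X p θ r t) (r t - θ ⬝ᵥ (X t *ᵥ p t)) := by
  have hS : noiseSum X p θ r (t + 1)
      = noiseSum X p θ r t + (r t - θ ⬝ᵥ (X t *ᵥ p t)) • (X t *ᵥ p t) := by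
    rw [noiseSum, noiseSum, Finset.sum_range_succ]
  rw [selfNormExp, selfNormExp, hS, gram_succ, quadForm_inv_update (gram_posDef X p t), ← gram_succ,
    det_gram_succ, Real.sqrt_mul (gram_posDef X p t).det_pos.le, growth, mul_add, Real.exp_add]
  unfold width noiseCorr
  field_simp

theorem gram_mulVec (t : ℕ) (θ : Fin m → ℝ) :
    gram X p t *ᵥ θ = θ + ∑ i ∈ Finset.range t, (θ ⬝ᵥ (X i *ᵥ p i)) • (X i *ᵥ p i) := by
  rw [gram, Matrix.add_mulVec, Matrix.one_mulVec, Matrix.sum_mulVec]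
  simp_rw [vecMulVec_self_mulVec, dotProduct_comm θ]

/-- The term `-θ` is the bias caused by the identity matrix in `gram`. -/
theorem muHat_sub (t : ℕ) :
    muHat X p r t - θ = (gram X p t)⁻¹ *ᵥ (noiseSum X p θ r t + -θ) := by
  have h : noiseSum X p θ r t + -θ
      = ∑ i ∈ Finset.range t, r i • (X i *ᵥ p i) - gram X p t *ᵥ θ := by
    rw [gram_mulVec, noiseSum]
    simp_rw [sub_smul]
    rw [Finset.sum_sub_distrib]
    abel
  rw [h, Matrix.mulVec_sub, inv_mulVec_mulVec (gram_posDef X p t), muHat]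

variable {X p θ r}

theorem mNorm_gram_inv_le (hθ : ∀ l, θ l ∈ Set.Icc (0 : ℝ) 1) (t : ℕ) :
    mNorm (gram X p t)⁻¹ θ ≤ √m :=
  Real.sqrt_le_sqrt ((quadForm_gram_inv_le X p t θ).trans (dotProduct_self_le hθ))

theorem abs_muHat_sub_dotProduct_le (hθ : ∀ l, θ l ∈ Set.Icc (0 : ℝ) 1) (t : ℕ)
    (x : Fin m → ℝ) :
    |muHat X p r t ⬝ᵥ x - θ ⬝ᵥ x| ≤
      (mNorm (gram X p t)⁻¹ (noiseSum X p θ r t) + √m) * mNorm (gram X p t)⁻¹ x := by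
  have hA := gram_inv_posSemidef X p t
  rw [← sub_dotProduct, muHat_sub X p θ r, dotProduct_comm]
  refine (abs_dotProduct_mulVec_le hA _ _).trans ?_
  rw [mul_comm]
  gcongr
  · exact mNorm_nonneg _ _
  · refine (mNorm_add_le hA _ _).trans ?_
    rw [mNorm_neg]
    gcongr
    exact mNorm_gram_inv_le hθ t

theorem mNorm_noiseSum_le {t : ℕ} {L : ℝ}
    (hX : ∀ i < t, ∀ l, (X i *ᵥ p i) l ∈ Set.Icc (0 : ℝ) 1)
    (h : selfNormExp X p θ r t ≤ Real.exp L) :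
    mNorm (gram X p t)⁻¹ (noiseSum X p θ r t) ≤ √(L / 2 + m * Real.log (1 + t) / 4) := by
  refine Real.sqrt_le_sqrt ?_
  have hdet := (gram_posDef X p t).det_pos
  have hl := log_det_gram_le hX
  rw [selfNormExp, div_le_iff₀ (Real.sqrt_pos.2 hdet), ← Real.exp_log (Real.sqrt_pos.2 hdet),
    ← Real.exp_add, Real.exp_le_exp, Real.log_sqrt hdet.le] at h
  linarith

/-- The total estimation error along any arms whose width is at most that of the arms played. -/
theorem sum_abs_muHat_sub_le {N : ℕ} {L : ℝ} {x : ℕ → Fin m → ℝ} (hN : 2 ≤ N) (hmN : m ^ 2 ≤ N)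
    (hL : 16 + Real.log N ≤ L)
    (hX : ∀ i < N, ∀ l, (X i *ᵥ p i) l ∈ Set.Icc (0 : ℝ) 1)
    (hθ : ∀ l, θ l ∈ Set.Icc (0 : ℝ) 1)
    (hS : ∀ i < N, selfNormExp X p θ r i ≤ Real.exp L)
    (hx : ∀ i < N, mNorm (gram X p i)⁻¹ (x i) ≤ √(width X p i)) :
    ∑ i ∈ Finset.range N, |muHat X p r i ⬝ᵥ x i - θ ⬝ᵥ x i|
      ≤ 3 * (m * √(N * Real.log N * L)) := by
  rcases Nat.eq_zero_or_pos m with rfl | hm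
  · simp [dotProduct]
  have hN' : (2 : ℝ) ≤ N := by exact_mod_cast hN
  have hm' : (1 : ℝ) ≤ m := by exact_mod_cast hm
  have hlN : 0 < Real.log N := Real.log_pos (by linarith)
  have hL16 : 16 ≤ L := by linarith
  have hlog : Real.log (1 + N) ≤ L := by
    have h2 : Real.log 2 + Real.log N ≤ L := by
      have := Real.log_two_lt_d9
      linarith
    rw [← Real.log_mul (by norm_num) (by linarith)] at h2
    exact (Real.log_le_log (by linarith) (by linarith)).trans h2
  -- Here `1.1161 = 0.8661 + 0.25`: the noise contributes `√(1/2 + 1/4) < 0.8661`, and the bias `√m`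
  -- contributes `0.25` because `16 ≤ L`. The product `1.1161 * 2.6405` is just below `3`.
  set β : ℝ := 1.1161 * √(m * L) with hβ
  have hβle : ∀ i < N, mNorm (gram X p i)⁻¹ (noiseSum X p θ r i) + √m ≤ β := by
    intro i hi
    have hiN : (i : ℝ) ≤ N := by exact_mod_cast hi.le
    have h1 : mNorm (gram X p i)⁻¹ (noiseSum X p θ r i) ≤ 0.8661 * √(m * L) := by
      refine (mNorm_noiseSum_le (fun j hj => hX j (hj.trans hi)) (hS i hi)).trans ?_
      have h3 : L / 2 + m * Real.log (1 + i) / 4 ≤ 0.8661 ^ 2 * (m * L) := by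
        have h4 : Real.log (1 + i) ≤ L :=
          (Real.log_le_log (by positivity) (by linarith)).trans hlog
        have h5 : m * Real.log (1 + i) ≤ m * L := by gcongr
        have h6 : L ≤ m * L := by nlinarith
        linarith
      refine (Real.sqrt_le_sqrt h3).trans ?_
      rw [Real.sqrt_mul (by positivity), Real.sqrt_sq (by norm_num)]
    have h2 : √m ≤ 0.25 * √(m * L) := by
      rw [show (0.25 : ℝ) * √(m * L) = √(0.25 ^ 2 * (m * L)) by
        rw [Real.sqrt_mul (by norm_num : (0 : ℝ) ≤ 0.25 ^ 2), Real.sqrt_sq (by norm_num)]]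
      refine Real.sqrt_le_sqrt ?_
      nlinarith
    rw [hβ]
    linarith
  have hβ0 : 0 ≤ β := by positivity
  calc ∑ i ∈ Finset.range N, |muHat X p r i ⬝ᵥ x i - θ ⬝ᵥ x i|
      ≤ ∑ i ∈ Finset.range N, β * √(width X p i) := by
        refine Finset.sum_le_sum fun i hi => ?_
        have hi' := Finset.mem_range.1 hi
        refine (abs_muHat_sub_dotProduct_le hθ i (x i)).trans ?_
        exact mul_le_mul (hβle i hi') (hx i hi') (mNorm_nonneg _ _) hβ0
    _ = β * ∑ i ∈ Finset.range N, √(width X p i) := by rw [Finset.mul_sum]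
    _ ≤ β * (2.6405 * √(N * (m * Real.log N))) := by
        gcongr
        exact sum_sqrt_width_le hN hm hmN hX
    _ = 1.1161 * 2.6405 * (√(m * L) * √(N * (m * Real.log N))) := by rw [hβ]; ring
    _ = 1.1161 * 2.6405 * (m * √(N * Real.log N * L)) := by
        rw [← Real.sqrt_mul (by positivity), show (m : ℝ) * L * (N * (m * Real.log N))
          = m ^ 2 * (N * Real.log N * L) by ring, Real.sqrt_mul (by positivity),
          Real.sqrt_sq (by positivity)]
    _ ≤ 3 * (m * √(N * Real.log N * L)) := by
        gcongr
        norm_num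

/-- Lets the Hoeffding deviation be measured in the same unit as the regression error. -/
theorem sqrt_half_mul_le {N : ℕ} {L : ℝ} (hN : 2 ≤ N) (hm : 1 ≤ m) (hL : 0 ≤ L) :
    √(N * L / 2) ≤ m * √(N * Real.log N * L) := by
  have hN' : (2 : ℝ) ≤ N := by exact_mod_cast hN
  have hm' : (1 : ℝ) ≤ m := by exact_mod_cast hm
  have h2 : 0.5 ≤ Real.log N := by
    have := Real.log_two_gt_d9
    have := Real.log_le_log (by norm_num) hN'
    linarith
  calc √(N * L / 2) ≤ √(N * Real.log N * L) := by
        refine Real.sqrt_le_sqrt ?_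
        have : 0 ≤ N * L := by positivity
        nlinarith
    _ ≤ _ := le_mul_of_one_le_left (Real.sqrt_nonneg _) hm'

end Estimate

/-! ### Conditional expectations of bounded random variables -/

section Conditional

variable {Ω : Type*} {mΩ : MeasurableSpace Ω} {P : Measure Ω}

/-- The densities `f` and `g` define the same measure on `G`. Working with lower integrals removes
any integrability condition on the weight. -/
theorem lintegral_mul_congr_of_setLIntegral {G : MeasurableSpace Ω} (hG : G ≤ mΩ)
    {f g : Ω → ENNReal} (hf : AEMeasurable f P) (hg : AEMeasurable g P)
    (h : ∀ s, MeasurableSet[G] s → ∫⁻ ω in s, f ω ∂P = ∫⁻ ω in s, g ω ∂P)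
    {w : Ω → ENNReal} (hw : Measurable[G] w) :
    ∫⁻ ω, f ω * w ω ∂P = ∫⁻ ω, g ω * w ω ∂P := by
  have hm : (P.withDensity f).trim hG = (P.withDensity g).trim hG := by
    refine @Measure.ext _ G _ _ fun s hs => ?_
    rw [trim_measurableSet_eq hG hs, trim_measurableSet_eq hG hs,
      withDensity_apply _ (hG s hs), withDensity_apply _ (hG s hs), h s hs]
  have hw' : AEMeasurable w P := (hw.mono hG le_rfl).aemeasurable
  have e : ∀ k : Ω → ENNReal, AEMeasurable k P →
      ∫⁻ ω, k ω * w ω ∂P = ∫⁻ ω, w ω ∂(P.withDensity k).trim hG := by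
    intro k hk
    rw [lintegral_trim hG hw, lintegral_withDensity_eq_lintegral_mul₀ hk hw']
    rfl
  rw [e f hf, e g hg, hm]

variable [IsProbabilityMeasure P]

theorem lintegral_ofReal_mul_congr {G : MeasurableSpace Ω} (hG : G ≤ mΩ) {r q : Ω → ℝ}
    (hr : Integrable r P) (hr0 : 0 ≤ᵐ[P] r) (hq : P[r | G] =ᵐ[P] q)
    {w : Ω → ENNReal} (hw : Measurable[G] w) :
    ∫⁻ ω, ENNReal.ofReal (r ω) * w ω ∂P = ∫⁻ ω, ENNReal.ofReal (q ω) * w ω ∂P := by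
  have hqi : Integrable q P := integrable_condExp.congr hq
  have hq0 : 0 ≤ᵐ[P] q := by
    filter_upwards [condExp_nonneg (m := G) hr0, hq] with ω h1 h2
    rwa [h2] at h1
  refine lintegral_mul_congr_of_setLIntegral hG hr.aemeasurable.ennreal_ofReal
    hqi.aemeasurable.ennreal_ofReal (fun s hs => ?_) hw
  rw [← ofReal_integral_eq_lintegral_ofReal hr.integrableOn (ae_restrict_of_ae hr0),
    ← ofReal_integral_eq_lintegral_ofReal hqi.integrableOn (ae_restrict_of_ae hq0),
    ← setIntegral_condExp hG hr hs, setIntegral_congr_ae (hG s hs) (hq.mono fun ω h _ => h)]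

/-- A convex function of a `[0, 1]`-valued variable is bounded by its chord, so that its mean is
controlled by the conditional mean of the variable. -/
theorem lintegral_le_of_chord {G : MeasurableSpace Ω} (hG : G ≤ mΩ) {r q : Ω → ℝ}
    (hr : Integrable r P) (hr01 : ∀ᵐ ω ∂P, r ω ∈ Set.Icc (0 : ℝ) 1) (hq : P[r | G] =ᵐ[P] q)
    {w₀ w₁ w f : Ω → ℝ} (hw₀ : Measurable[G] w₀) (hw₁ : Measurable[G] w₁)
    (hw₀n : ∀ ω, 0 ≤ w₀ ω) (hw₁n : ∀ ω, 0 ≤ w₁ ω)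
    (hf : ∀ᵐ ω ∂P, f ω ≤ (1 - r ω) * w₀ ω + r ω * w₁ ω)
    (hw : ∀ᵐ ω ∂P, q ω ∈ Set.Icc (0 : ℝ) 1 → (1 - q ω) * w₀ ω + q ω * w₁ ω ≤ w ω) :
    ∫⁻ ω, ENNReal.ofReal (f ω) ∂P ≤ ∫⁻ ω, ENNReal.ofReal (w ω) ∂P := by
  have hqi : Integrable q P := integrable_condExp.congr hq
  have hr' : Integrable (fun ω => 1 - r ω) P := (integrable_const 1).sub hr
  have hq' : P[fun ω => 1 - r ω | G] =ᵐ[P] fun ω => 1 - q ω := by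
    have h := condExp_sub (integrable_const (1 : ℝ)) hr G
    rw [condExp_const hG] at h
    filter_upwards [h, hq] with ω h1 h2
    rw [← h2]
    exact h1
  have hr0 : 0 ≤ᵐ[P] r := hr01.mono fun ω h => h.1
  have hr1 : 0 ≤ᵐ[P] fun ω => 1 - r ω := hr01.mono fun ω h => sub_nonneg.2 h.2
  have hq01 : ∀ᵐ ω ∂P, q ω ∈ Set.Icc (0 : ℝ) 1 := by
    filter_upwards [condExp_nonneg (m := G) hr0, condExp_nonneg (m := G) hr1, hq, hq']
      with ω h1 h2 h3 h4
    rw [h3] at h1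
    rw [h4] at h2
    exact ⟨h1, sub_nonneg.1 h2⟩
  have hm₀ : Measurable[G] fun ω => ENNReal.ofReal (w₀ ω) := hw₀.ennreal_ofReal
  have hm₁ : Measurable[G] fun ω => ENNReal.ofReal (w₁ ω) := hw₁.ennreal_ofReal
  have split : ∀ k : Ω → ℝ, Integrable k P → (∀ᵐ ω ∂P, k ω ∈ Set.Icc (0 : ℝ) 1) →
      ∫⁻ ω, ENNReal.ofReal ((1 - k ω) * w₀ ω + k ω * w₁ ω) ∂P =
      ∫⁻ ω, ENNReal.ofReal (1 - k ω) * ENNReal.ofReal (w₀ ω) ∂P +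
        ∫⁻ ω, ENNReal.ofReal (k ω) * ENNReal.ofReal (w₁ ω) ∂P := by
    intro k hk hk01
    have hm : AEMeasurable (fun ω => ENNReal.ofReal (k ω) * ENNReal.ofReal (w₁ ω)) P :=
      hk.aemeasurable.ennreal_ofReal.mul (hm₁.mono hG le_rfl).aemeasurable
    rw [← lintegral_add_right' _ hm]
    refine lintegral_congr_ae (hk01.mono fun ω h => ?_)
    simp only
    rw [ENNReal.ofReal_add (mul_nonneg (sub_nonneg.2 h.2) (hw₀n ω)) (mul_nonneg h.1 (hw₁n ω)),
      ENNReal.ofReal_mul (sub_nonneg.2 h.2), ENNReal.ofReal_mul h.1]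
  calc ∫⁻ ω, ENNReal.ofReal (f ω) ∂P
      ≤ ∫⁻ ω, ENNReal.ofReal ((1 - r ω) * w₀ ω + r ω * w₁ ω) ∂P :=
        lintegral_mono_ae (hf.mono fun ω h => ENNReal.ofReal_le_ofReal h)
    _ = ∫⁻ ω, ENNReal.ofReal ((1 - q ω) * w₀ ω + q ω * w₁ ω) ∂P := by
        rw [split r hr hr01, split q hqi hq01, lintegral_ofReal_mul_congr hG hr hr0 hq hm₁,
          lintegral_ofReal_mul_congr hG hr' hr1 hq' hm₀]
    _ ≤ ∫⁻ ω, ENNReal.ofReal (w ω) ∂P :=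
        lintegral_mono_ae ((hw.and hq01).mono fun ω h => ENNReal.ofReal_le_ofReal (h.1 h.2))

theorem integrable_of_mem_Icc {f : Ω → ℝ} (hf : Measurable f)
    (h : ∀ᵐ ω ∂P, f ω ∈ Set.Icc (0 : ℝ) 1) : Integrable f P :=
  Integrable.of_mem_Icc 0 1 hf.aemeasurable h

end Conditional

/-! ### Conditioning on a join with independent information -/

theorem isPiSystem_inter {Ω : Type*} (F G : MeasurableSpace Ω) :
    IsPiSystem {s | ∃ a b, MeasurableSet[F] a ∧ MeasurableSet[G] b ∧ s = a ∩ b} := by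
  rintro _ ⟨a, b, ha, hb, rfl⟩ _ ⟨a', b', ha', hb', rfl⟩ -
  exact ⟨a ∩ a', b ∩ b', ha.inter ha', hb.inter hb', Set.inter_inter_inter_comm _ _ _ _⟩

theorem sup_eq_generateFrom_inter {Ω : Type*} (F G : MeasurableSpace Ω) :
    F ⊔ G = MeasurableSpace.generateFrom
      {s | ∃ a b, MeasurableSet[F] a ∧ MeasurableSet[G] b ∧ s = a ∩ b} := by
  refine le_antisymm (sup_le ?_ ?_) (MeasurableSpace.generateFrom_le ?_)
  · exact fun s hs => MeasurableSpace.measurableSet_generateFrom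
      ⟨s, Set.univ, hs, MeasurableSet.univ, (Set.inter_univ s).symm⟩
  · exact fun s hs => MeasurableSpace.measurableSet_generateFrom
      ⟨Set.univ, s, MeasurableSet.univ, hs, (Set.univ_inter s).symm⟩
  · rintro _ ⟨a, b, ha, hb, rfl⟩
    have h1 : MeasurableSet[F ⊔ G] a := (le_sup_left : F ≤ F ⊔ G) a ha
    have h2 : MeasurableSet[F ⊔ G] b := (le_sup_right : G ≤ F ⊔ G) b hb
    exact MeasurableSet.inter h1 h2

/-- Information independent of a variable does not change its conditional expectation. -/
theorem condExp_sup_of_indep {Ω : Type*} {F G H mΩ : MeasurableSpace Ω} {P : Measure Ω}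
    [IsProbabilityMeasure P] (hF : F ≤ mΩ) (hH : H ≤ mΩ)
    (hGH : G ≤ H) (hind : ProbabilityTheory.Indep H F P) {f g : Ω → ℝ} (hf : Measurable[H] f)
    (hg : Measurable[G] g) (hf01 : ∀ᵐ ω ∂P, f ω ∈ Set.Icc (0 : ℝ) 1)
    (hg01 : ∀ᵐ ω ∂P, g ω ∈ Set.Icc (0 : ℝ) 1)
    (h : ∀ s, MeasurableSet[G] s → ∫ ω in s, f ω ∂P = ∫ ω in s, g ω ∂P) :
    P[f | F ⊔ G] =ᵐ[P] g := by
  have hfi : Integrable f P := integrable_of_mem_Icc (hf.mono hH le_rfl) hf01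
  have hgH : Measurable[H] g := hg.mono hGH le_rfl
  have hgi : Integrable g P := integrable_of_mem_Icc (hgH.mono hH le_rfl) hg01
  have hf0 : 0 ≤ᵐ[P] f := hf01.mono fun ω h => h.1
  have hg0 : 0 ≤ᵐ[P] g := hg01.mono fun ω h => h.1
  have hsup : F ⊔ G ≤ mΩ := sup_le hF (hGH.trans hH)
  -- By independence the integral over `a ∩ b` factors; such sets form a π-system generating `F ⊔
  -- G`.
  have key : ∀ k : Ω → ℝ, Measurable[H] k → Integrable k P → 0 ≤ᵐ[P] k → ∀ a b,
      MeasurableSet[F] a → MeasurableSet[G] b →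
      ∫⁻ ω in a ∩ b, ENNReal.ofReal (k ω) ∂P = ENNReal.ofReal (∫ ω in b, k ω ∂P) * P a := by
    intro k hk hki hk0 a b ha hb
    have hb' : MeasurableSet[H] b := hGH b hb
    have ha1 : Measurable[F] (a.indicator (1 : Ω → ENNReal)) :=
      Measurable.indicator (@measurable_const _ _ _ F 1) ha
    rw [← lintegral_indicator ((hF a ha).inter (hH b hb')),
      ofReal_integral_eq_lintegral_ofReal hki.integrableOn (ae_restrict_of_ae hk0),
      ← lintegral_indicator (hH b hb'), ← lintegral_indicator_one (hF a ha),
      ← ProbabilityTheory.lintegral_mul_eq_lintegral_mul_lintegral_of_independent_measurableSpace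
        hH hF hind (hk.ennreal_ofReal.indicator hb') ha1]
    refine lintegral_congr fun ω => ?_
    by_cases h1 : ω ∈ a <;> by_cases h2 : ω ∈ b <;> simp [h1, h2]
  have hfin : IsFiniteMeasure (P.withDensity fun ω => ENNReal.ofReal (f ω)) :=
    isFiniteMeasure_withDensity_ofReal hfi.2
  have hset : ∀ s, MeasurableSet[F ⊔ G] s →
      ∫⁻ ω in s, ENNReal.ofReal (f ω) ∂P = ∫⁻ ω in s, ENNReal.ofReal (g ω) ∂P := by
    intro s hs
    have hgen : ∀ s ∈ {s | ∃ a b, MeasurableSet[F] a ∧ MeasurableSet[G] b ∧ s = a ∩ b},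
        (P.withDensity fun ω => ENNReal.ofReal (f ω)) s
          = (P.withDensity fun ω => ENNReal.ofReal (g ω)) s := by
      rintro _ ⟨a, b, ha, hb, rfl⟩
      have hab : MeasurableSet (a ∩ b) := (hF a ha).inter (hH b (hGH b hb))
      rw [withDensity_apply _ hab, withDensity_apply _ hab, key f hf hfi hf0 a b ha hb,
        key g hgH hgi hg0 a b ha hb, h b hb]
    have := ext_on_measurableSpace_of_generate_finite mΩ _ hgen hsup
      (sup_eq_generateFrom_inter F G) (isPiSystem_inter F G)
      (hgen _ ⟨Set.univ, Set.univ, MeasurableSet.univ, MeasurableSet.univ, by simp⟩) hs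
    rwa [withDensity_apply _ (hsup s hs), withDensity_apply _ (hsup s hs)] at this
  refine (ae_eq_condExp_of_forall_setIntegral_eq hsup hfi (fun s _ _ => hgi.integrableOn)
    (fun s hs _ => ?_) ?_).symm
  · rw [integral_eq_lintegral_of_nonneg_ae (ae_restrict_of_ae hg0)
      hgi.integrableOn.aestronglyMeasurable,
      integral_eq_lintegral_of_nonneg_ae (ae_restrict_of_ae hf0)
      hfi.integrableOn.aestronglyMeasurable, hset s hs]
  · exact (hg.mono (le_sup_right : G ≤ F ⊔ G) le_rfl).stronglyMeasurable.aestronglyMeasurable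

/-! ### Measurability of the estimates -/

section Measurability

variable {Ω : Type*} {F : MeasurableSpace Ω} {n k : ℕ}

theorem measurable_matrix {f : Ω → Matrix (Fin n) (Fin k) ℝ}
    (h : ∀ i j, Measurable fun ω => f ω i j) : Measurable f :=
  measurable_pi_lambda (fun ω => (f ω : Fin n → Fin k → ℝ)) fun i => measurable_pi_lambda _ (h i)

theorem measurable_entry {f : Ω → Matrix (Fin n) (Fin k) ℝ} (h : Measurable f) (i : Fin n)
    (j : Fin k) : Measurable fun ω => f ω i j :=
  (measurable_pi_apply j).comp ((measurable_pi_apply (X := fun _ : Fin n => Fin k → ℝ) i).comp h)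

theorem measurable_coord {f : Ω → Fin n → ℝ} (h : Measurable f) (i : Fin n) :
    Measurable fun ω => f ω i := (measurable_pi_apply i).comp h

theorem measurable_dotProduct {f g : Ω → Fin n → ℝ} (hf : Measurable f) (hg : Measurable g) :
    Measurable fun ω => f ω ⬝ᵥ g ω :=
  Finset.measurable_sum _ fun i _ => (measurable_coord hf i).mul (measurable_coord hg i)

theorem measurable_mulVec {A : Ω → Matrix (Fin n) (Fin k) ℝ} {f : Ω → Fin k → ℝ}
    (hA : Measurable A) (hf : Measurable f) : Measurable fun ω => A ω *ᵥ f ω :=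
  measurable_pi_lambda _ fun i =>
    Finset.measurable_sum Finset.univ fun j _ => (measurable_entry hA i j).mul (measurable_coord hf j)

theorem measurable_vecMul {A : Ω → Matrix (Fin n) (Fin k) ℝ} {f : Ω → Fin n → ℝ}
    (hA : Measurable A) (hf : Measurable f) : Measurable fun ω => f ω ᵥ* A ω :=
  measurable_pi_lambda _ fun j =>
    Finset.measurable_sum Finset.univ fun i _ =>
      (measurable_coord hf i).mul (measurable_entry hA i j)

theorem measurable_det {A : Ω → Matrix (Fin n) (Fin n) ℝ} (hA : Measurable A) :
    Measurable fun ω => (A ω).det := by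
  simp_rw [Matrix.det_apply]
  exact Finset.measurable_sum _ fun σ _ =>
    (Finset.measurable_prod _ fun i _ => measurable_entry hA _ _).const_smul _

/-- Cramer's rule; it also covers singular matrices, where both sides are zero. -/
theorem measurable_inv {A : Ω → Matrix (Fin n) (Fin n) ℝ} (hA : Measurable A) :
    Measurable fun ω => (A ω)⁻¹ := by
  refine measurable_matrix fun i j => ?_
  have h : ∀ ω, (A ω)⁻¹ i j = ((A ω).det)⁻¹ * ((A ω).updateRow j (Pi.single i 1)).det := by
    intro ω
    rw [Matrix.inv_def, Matrix.smul_apply, Matrix.adjugate_apply, Ring.inverse_eq_inv', smul_eq_mul]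
  simp_rw [h]
  refine (measurable_det hA).inv.mul (measurable_det (measurable_matrix fun a b => ?_))
  simp_rw [Matrix.updateRow_apply]
  by_cases hab : a = j
  · simp [hab]
  · simpa [hab] using measurable_entry hA a b

variable {X : ℕ → Ω → Context m K} {p : ℕ → Ω → Fin K → ℝ} {t : ℕ}

theorem measurable_gram (hX : ∀ i < t, Measurable (X i)) (hp : ∀ i < t, Measurable (p i)) :
    Measurable fun ω => gram (fun i => X i ω) (fun i => p i ω) t := by
  refine measurable_matrix fun a b => ?_
  simp_rw [gram, Matrix.add_apply, Matrix.sum_apply, Matrix.vecMulVec_apply]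
  refine measurable_const.add (Finset.measurable_sum _ fun i hi => ?_)
  have h := measurable_mulVec (hX i (Finset.mem_range.1 hi)) (hp i (Finset.mem_range.1 hi))
  exact (measurable_coord h a).mul (measurable_coord h b)

theorem measurable_noiseSum (hX : ∀ i < t, Measurable (X i)) (hp : ∀ i < t, Measurable (p i))
    {r : ℕ → Ω → ℝ} (hr : ∀ i < t, Measurable (r i)) (θ : Fin m → ℝ) :
    Measurable fun ω => noiseSum (fun i => X i ω) (fun i => p i ω) θ (fun i => r i ω) t := by
  refine Finset.measurable_sum _ fun i hi => ?_
  have hi := Finset.mem_range.1 hi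
  have h := measurable_mulVec (hX i hi) (hp i hi)
  exact ((hr i hi).sub (measurable_dotProduct measurable_const h)).smul h

theorem measurable_selfNormExp (hX : ∀ i < t, Measurable (X i)) (hp : ∀ i < t, Measurable (p i))
    {r : ℕ → Ω → ℝ} (hr : ∀ i < t, Measurable (r i)) (θ : Fin m → ℝ) :
    Measurable fun ω => selfNormExp (fun i => X i ω) (fun i => p i ω) θ (fun i => r i ω) t := by
  have hS := measurable_noiseSum hX hp hr θ
  have hg := measurable_gram hX hp
  exact ((measurable_dotProduct hS (measurable_mulVec (measurable_inv hg) hS)).const_mul 2).exp.div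
    (measurable_det hg).sqrt

theorem measurable_growth {u a x : Ω → ℝ} (hu : Measurable u) (ha : Measurable a)
    (hx : Measurable x) : Measurable fun ω => growth (u ω) (a ω) (x ω) := by
  unfold growth
  fun_prop

theorem measurable_apply_arm {n : ℕ} {f : Ω → Fin n → ℝ} {A : Ω → Fin n} (hf : Measurable f)
    (hA : Measurable A) : Measurable fun ω => f ω (A ω) := by
  have h : ∀ ω, f ω (A ω) = ∑ a, if A ω = a then f ω a else 0 := fun ω => by simp
  simp_rw [h]
  exact Finset.measurable_sum _ fun a _ =>
    Measurable.ite (hA (measurableSet_singleton a)) (measurable_coord hf a) measurable_const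

end Measurability

/-! ### Observed signals -/

/-- A `[0, 1]`-valued quantity attached to every arm, with conditional mean linear in the contexts:
either the reward or the consumption of one of the resources. -/
structure IsSignal (D : Measure (Outcome m K d)) (h : Outcome m K d → Fin K → ℝ)
    (θ : Fin m → ℝ) : Prop where
  measurable : Measurable h
  mem : ∀ᵐ y ∂D, ∀ a, h y a ∈ Set.Icc (0 : ℝ) 1
  param_mem : ∀ l, θ l ∈ Set.Icc (0 : ℝ) 1
  linear : ∀ a, D[fun y => h y a | MeasurableSpace.comap Prod.fst inferInstance]
    =ᵐ[D] fun y => (θ ᵥ* y.1) a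

theorem IsInstance.isSignal_reward {D : Measure (Outcome m K d)} {μ : Fin m → ℝ}
    {W : Matrix (Fin m) (Fin d) ℝ} (hD : IsInstance D μ W) :
    IsSignal D (fun y => y.2.1) μ where
  measurable := measurable_fst.comp measurable_snd
  mem := hD.reward_mem
  param_mem := hD.mu_mem
  linear := hD.reward_linear

theorem IsInstance.isSignal_consumption {D : Measure (Outcome m K d)} {μ : Fin m → ℝ}
    {W : Matrix (Fin m) (Fin d) ℝ} (hD : IsInstance D μ W) (j : Fin d) :
    IsSignal D (fun y a => y.2.2 j a) (fun l => W l j) where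
  measurable := measurable_pi_lambda _ fun a =>
    measurable_entry (measurable_snd.comp measurable_snd) j a
  mem := hD.consumption_mem.mono fun _ h a => h j a
  param_mem := fun l => hD.W_mem l j
  linear := fun a => hD.consumption_linear j a

theorem comap_fst_le : MeasurableSpace.comap (Prod.fst : Outcome m K d → Context m K) inferInstance
    ≤ (inferInstance : MeasurableSpace (Outcome m K d)) := measurable_fst.comap_le

theorem measurable_mean (θ : Fin m → ℝ) (a : Fin K) :
    Measurable fun X : Context m K => (θ ᵥ* X) a :=
  measurable_coord (measurable_vecMul measurable_id measurable_const) a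

section Signal

variable {D : Measure (Outcome m K d)} [IsProbabilityMeasure D] {h : Outcome m K d → Fin K → ℝ}
  {θ : Fin m → ℝ}

theorem IsSignal.integrable (hs : IsSignal D h θ) (a : Fin K) : Integrable (fun y => h y a) D :=
  integrable_of_mem_Icc (measurable_coord hs.measurable a) (hs.mem.mono fun _ hy => hy a)

/-- The bounds on `θ` and the contexts alone would allow values up to `m`. The range `[0, 1]` comes
from the mean being a conditional expectation of a `[0, 1]`-valued signal. -/
theorem IsSignal.mean_mem (hs : IsSignal D h θ) :
    ∀ᵐ y ∂D, ∀ a, (θ ᵥ* y.1) a ∈ Set.Icc (0 : ℝ) 1 := by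
  rw [ae_all_iff]
  intro a
  have h0 := condExp_nonneg (μ := D) (m := MeasurableSpace.comap Prod.fst inferInstance)
    (f := fun y => h y a) (hs.mem.mono fun y hy => (hy a).1)
  have h1 := condExp_mono (m := MeasurableSpace.comap Prod.fst inferInstance)
    (hs.integrable a) (integrable_const (1 : ℝ)) (hs.mem.mono fun y hy => (hy a).2)
  rw [condExp_const comap_fst_le] at h1
  filter_upwards [h0, h1, hs.linear a] with y h0 h1 h2
  rw [h2] at h0 h1
  exact ⟨h0, h1⟩

theorem IsSignal.setIntegral_eq (hs : IsSignal D h θ) (a : Fin K) {B : Set (Context m K)}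
    (hB : MeasurableSet B) :
    ∫ y in Prod.fst ⁻¹' B, h y a ∂D = ∫ y in Prod.fst ⁻¹' B, (θ ᵥ* y.1) a ∂D := by
  rw [← setIntegral_condExp comap_fst_le (hs.integrable a) ⟨B, hB, rfl⟩]
  exact setIntegral_congr_ae (measurable_fst hB) ((hs.linear a).mono fun y hy _ => hy)

end Signal

/-! ### The exploration process and its exponential supermartingale -/

section Exploration

variable {Ω : Type*} {mΩ : MeasurableSpace Ω} {P : Measure Ω}
  {D : Measure (Outcome m K d)} {T₀ : ℕ} {ℱ : Filtration ℕ mΩ}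
  {Y : ℕ → Ω → Outcome m K d} {p : ℕ → Ω → Fin K → ℝ} {A : ℕ → Ω → Fin K}
  {h : Outcome m K d → Fin K → ℝ} {θ : Fin m → ℝ} {t : ℕ}

theorem IsExploration.measurable_outcome (hE : IsExploration P D T₀ ℱ Y p A) (ht : t < T₀) :
    Measurable (Y t) := (hE.outcome_adapted t ht).mono (ℱ.le _) le_rfl

theorem IsExploration.ae_outcome (hE : IsExploration P D T₀ ℱ Y p A) (ht : t < T₀)
    {q : Outcome m K d → Prop} (hq : ∀ᵐ y ∂D, q y) : ∀ᵐ ω ∂P, q (Y t ω) := by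
  rw [← hE.outcome_law t ht] at hq
  exact ae_of_ae_map (hE.measurable_outcome ht).aemeasurable hq

theorem IsExploration.comap_outcome_le (hE : IsExploration P D T₀ ℱ Y p A) (ht : t < T₀) :
    MeasurableSpace.comap (Y t) inferInstance ≤ mΩ := (hE.measurable_outcome ht).comap_le

theorem comap_context_le :
    MeasurableSpace.comap (fun ω => (Y t ω).1) inferInstance
      ≤ MeasurableSpace.comap (Y t) inferInstance := by
  rintro _ ⟨B, hB, rfl⟩
  exact ⟨Prod.fst ⁻¹' B, measurable_fst hB, rfl⟩

/-- The history before round `t` together with the contexts of round `t`. -/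
abbrev preInfo (ℱ : Filtration ℕ mΩ) (Y : ℕ → Ω → Outcome m K d) (t : ℕ) : MeasurableSpace Ω :=
  ℱ t ⊔ MeasurableSpace.comap (fun ω => (Y t ω).1) inferInstance

theorem IsExploration.preInfo_le (hE : IsExploration P D T₀ ℱ Y p A) (ht : t < T₀) :
    preInfo ℱ Y t ≤ mΩ :=
  sup_le (ℱ.le t) (comap_context_le.trans (hE.comap_outcome_le ht))

theorem IsExploration.preInfo_le_succ (hE : IsExploration P D T₀ ℱ Y p A) (ht : t < T₀) :
    preInfo ℱ Y t ≤ ℱ (t + 1) :=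
  sup_le (ℱ.mono t.le_succ) (comap_context_le.trans (hE.outcome_adapted t ht).comap_le)

theorem measurable_context_preInfo : Measurable[preInfo ℱ Y t] fun ω => (Y t ω).1 :=
  fun _ hB => (le_sup_right : _ ≤ preInfo ℱ Y t) _ ⟨_, hB, rfl⟩

theorem IsExploration.measurable_context_hist (hE : IsExploration P D T₀ ℱ Y p A) (ht : t ≤ T₀) :
    ∀ i < t, Measurable[ℱ t] fun ω => (Y i ω).1 := fun i hi =>
  measurable_fst.comp ((hE.outcome_adapted i (hi.trans_le ht)).mono (ℱ.mono hi) le_rfl)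

theorem IsExploration.measurable_choice_hist (hE : IsExploration P D T₀ ℱ Y p A) (ht : t ≤ T₀) :
    ∀ i < t, Measurable[ℱ t] (p i) := fun i hi =>
  (hE.choice_measurable i (hi.trans_le ht)).mono
    ((hE.preInfo_le_succ (hi.trans_le ht)).trans (ℱ.mono hi)) le_rfl

theorem IsExploration.measurable_obs_hist (hE : IsExploration P D T₀ ℱ Y p A) (hs : Measurable h)
    (ht : t ≤ T₀) : ∀ i < t, Measurable[ℱ t] fun ω => h (Y i ω) (A i ω) := fun i hi =>
  measurable_apply_arm
    (hs.comp ((hE.outcome_adapted i (hi.trans_le ht)).mono (ℱ.mono hi) le_rfl))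
    ((hE.arm_adapted i (hi.trans_le ht)).mono (ℱ.mono hi) le_rfl)

variable [IsProbabilityMeasure P] [IsProbabilityMeasure D]

theorem IsExploration.condExp_signal (hE : IsExploration P D T₀ ℱ Y p A) (hs : IsSignal D h θ)
    (ht : t < T₀) (a : Fin K) :
    P[fun ω => h (Y t ω) a | preInfo ℱ Y t] =ᵐ[P] fun ω => (θ ᵥ* (Y t ω).1) a := by
  have hY := hE.measurable_outcome ht
  have hha : Measurable fun y => h y a := measurable_coord hs.measurable a
  have hma : Measurable fun y : Outcome m K d => (θ ᵥ* y.1) a :=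
    (measurable_mean θ a).comp measurable_fst
  refine condExp_sup_of_indep (ℱ.le t) (hE.comap_outcome_le ht) comap_context_le
    (hE.outcome_indep t ht) (hha.comp (comap_measurable (Y t)))
    ((measurable_mean θ a).comp (comap_measurable fun ω => (Y t ω).1))
    (hE.ae_outcome ht (hs.mem.mono fun y hy => hy a))
    (hE.ae_outcome ht (hs.mean_mem.mono fun y hy => hy a)) ?_
  rintro _ ⟨B, hB, rfl⟩
  have hB' : MeasurableSet (Prod.fst ⁻¹' B : Set (Outcome m K d)) := measurable_fst hB
  have e := hs.setIntegral_eq a hB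
  rw [← hE.outcome_law t ht, setIntegral_map hB' hha.aestronglyMeasurable hY.aemeasurable,
    setIntegral_map hB' hma.aestronglyMeasurable hY.aemeasurable] at e
  exact e

/-- Conditioning in two stages: on the history and the full outcome, the arm drawn averages to `p
t`; on the history and the contexts alone, `p t` is known and the signal averages to its linear
mean. -/
theorem IsExploration.condExp_obs (hE : IsExploration P D T₀ ℱ Y p A) (hs : IsSignal D h θ)
    (ht : t < T₀) :
    P[fun ω => h (Y t ω) (A t ω) | preInfo ℱ Y t]
      =ᵐ[P] fun ω => θ ⬝ᵥ ((Y t ω).1 *ᵥ p t ω) := by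
  have hY := hE.measurable_outcome ht
  have hA : Measurable (A t) := (hE.arm_adapted t ht).mono (ℱ.le _) le_rfl
  have hH : ℱ t ⊔ MeasurableSpace.comap (Y t) inferInstance ≤ mΩ :=
    sup_le (ℱ.le t) (hE.comap_outcome_le ht)
  have hGH : preInfo ℱ Y t ≤ ℱ t ⊔ MeasurableSpace.comap (Y t) inferInstance :=
    sup_le_sup_left comap_context_le _
  set H : MeasurableSpace Ω := ℱ t ⊔ MeasurableSpace.comap (Y t) inferInstance with hHdef
  have hha : ∀ a, Measurable fun y => h y a := fun a => measurable_coord hs.measurable a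
  have hmem : ∀ᵐ ω ∂P, ∀ a, h (Y t ω) a ∈ Set.Icc (0 : ℝ) 1 := hE.ae_outcome ht hs.mem
  have hsig : ∀ a, Integrable (fun ω => h (Y t ω) a) P := fun a =>
    integrable_of_mem_Icc ((hha a).comp hY) (hmem.mono fun ω hω => hω a)
  have hbd : ∀ a, ∀ᵐ ω ∂P, ‖h (Y t ω) a‖ ≤ 1 := fun a => hmem.mono fun ω hω => by
    rw [Real.norm_eq_abs, abs_of_nonneg (hω a).1]
    exact (hω a).2
  have hpa : ∀ a, Measurable[preInfo ℱ Y t] fun ω => p t ω a := fun a =>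
    measurable_coord (hE.choice_measurable t ht) a
  have hpbd : ∀ a, ∀ᵐ ω ∂P, ‖p t ω a‖ ≤ 1 := fun a => (hE.choice_mem t ht).mono fun ω hω => by
    rw [Real.norm_eq_abs, abs_of_nonneg (hω.1 a), ← hω.2]
    exact Finset.single_le_sum (fun b _ => hω.1 b) (Finset.mem_univ a)
  have hind : ∀ a, Integrable (fun ω => if A t ω = a then (1 : ℝ) else 0) P := fun a =>
    integrable_of_mem_Icc
      (Measurable.ite (hA (measurableSet_singleton a)) measurable_const measurable_const)
      (ae_of_all _ fun ω => by split_ifs <;> simp)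
  have hterm : ∀ a, P[fun ω => h (Y t ω) a * (if A t ω = a then (1 : ℝ) else 0) | preInfo ℱ Y t]
      =ᵐ[P] fun ω => (θ ᵥ* (Y t ω).1) a * p t ω a := by
    intro a
    have hhH : StronglyMeasurable[H] fun ω => h (Y t ω) a :=
      (((hha a).comp (comap_measurable (Y t))).mono (le_sup_right : _ ≤ H)
        le_rfl).stronglyMeasurable
    have h1 : P[fun ω => h (Y t ω) a * (if A t ω = a then (1 : ℝ) else 0) | H]
        =ᵐ[P] fun ω => p t ω a * h (Y t ω) a := by
      filter_upwards [condExp_stronglyMeasurable_mul_of_bound hH hhH (hind a) 1 (hbd a),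
        hE.arm_law t ht a] with ω e1 e2
      refine e1.trans ?_
      rw [Pi.mul_apply, e2, mul_comm]
    have h2 : P[fun ω => p t ω a * h (Y t ω) a | preInfo ℱ Y t]
        =ᵐ[P] fun ω => (θ ᵥ* (Y t ω).1) a * p t ω a := by
      filter_upwards [condExp_stronglyMeasurable_mul_of_bound (hE.preInfo_le ht)
        (hpa a).stronglyMeasurable (hsig a) 1 (hpbd a), hE.condExp_signal hs ht a] with ω e1 e2
      refine e1.trans ?_
      rw [Pi.mul_apply, e2, mul_comm]
    exact (condExp_condExp_of_le hGH hH).symm.trans ((condExp_congr_ae h1).trans h2)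
  have hsum : (fun ω => h (Y t ω) (A t ω))
      = ∑ a, fun ω => h (Y t ω) a * (if A t ω = a then (1 : ℝ) else 0) := by
    ext ω
    simp
  have hint : ∀ a, Integrable (fun ω => h (Y t ω) a * (if A t ω = a then (1 : ℝ) else 0)) P :=
    fun a => (hind a).bdd_mul ((hha a).comp hY).aestronglyMeasurable (hbd a)
  rw [hsum]
  refine (condExp_finsetSum (fun a _ => hint a) _).trans ?_
  filter_upwards [ae_all_iff.2 hterm] with ω hω
  rw [Finset.sum_apply, Finset.sum_congr rfl fun a _ => hω a, Matrix.dotProduct_mulVec]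
  rfl

/-- The mean of the self-normalized exponential process is at most `1`. -/
theorem IsExploration.lintegral_selfNormExp_le (hE : IsExploration P D T₀ ℱ Y p A)
    (hs : IsSignal D h θ) (ht : t ≤ T₀) :
    ∫⁻ ω, ENNReal.ofReal (selfNormExp (fun i => (Y i ω).1) (fun i => p i ω) θ
      (fun i => h (Y i ω) (A i ω)) t) ∂P ≤ 1 := by
  induction t with
  | zero => simp [selfNormExp_zero]
  | succ t ih =>
    have ht' : t < T₀ := ht
    refine le_trans ?_ (ih ht'.le)
    have hX := hE.measurable_context_hist ht'.le
    have hp := hE.measurable_choice_hist ht'.le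
    have hr := hE.measurable_obs_hist hs.measurable ht'.le
    have hle : ℱ t ≤ preInfo ℱ Y t := le_sup_left
    have hv : Measurable[preInfo ℱ Y t] fun ω => (Y t ω).1 *ᵥ p t ω :=
      measurable_mulVec measurable_context_preInfo (hE.choice_measurable t ht')
    have hgram := (measurable_inv (measurable_gram hX hp)).mono hle le_rfl
    have hu : Measurable[preInfo ℱ Y t] fun ω => width (fun i => (Y i ω).1) (fun i => p i ω) t :=
      measurable_dotProduct hv (measurable_mulVec hgram hv)
    have ha : Measurable[preInfo ℱ Y t] fun ω => noiseCorr (fun i => (Y i ω).1)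
        (fun i => p i ω) θ (fun i => h (Y i ω) (A i ω)) t :=
      measurable_dotProduct hv
        (measurable_mulVec hgram ((measurable_noiseSum hX hp hr θ).mono hle le_rfl))
    have hQ := (measurable_selfNormExp hX hp hr θ).mono hle le_rfl
    have hq : Measurable[preInfo ℱ Y t] fun ω => θ ⬝ᵥ ((Y t ω).1 *ᵥ p t ω) :=
      measurable_dotProduct measurable_const hv
    have hQu := hQ.div (hu.const_add 1).sqrt
    have hobs : Measurable fun ω => h (Y t ω) (A t ω) :=
      (hE.measurable_obs_hist hs.measurable ht t t.lt_succ_self).mono (ℱ.le _) le_rfl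
    have hobs01 : ∀ᵐ ω ∂P, h (Y t ω) (A t ω) ∈ Set.Icc (0 : ℝ) 1 :=
      (hE.ae_outcome ht' hs.mem).mono fun ω hω => hω _
    -- Given the history and the contexts, only the observation is random. The two weights are the
    -- values of the process after an observation of `0` and of `1`.
    refine lintegral_le_of_chord (hE.preInfo_le ht') (integrable_of_mem_Icc hobs hobs01) hobs01
      (hE.condExp_obs hs ht') (hQu.mul (measurable_growth hu ha hq.neg))
      (hQu.mul (measurable_growth hu ha (hq.const_sub 1))) (fun ω => ?_) (fun ω => ?_)
      (hobs01.mono fun ω hω => ?_) (ae_of_all _ fun ω hω => ?_)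
    · exact mul_nonneg (div_nonneg (selfNormExp_nonneg _ _ _ _ _) (Real.sqrt_nonneg _))
        (growth_pos _ _ _).le
    · exact mul_nonneg (div_nonneg (selfNormExp_nonneg _ _ _ _ _) (Real.sqrt_nonneg _))
        (growth_pos _ _ _).le
    · have h1 := growth_le_chord (width_nonneg (fun i => (Y i ω).1) (fun i => p i ω) t)
        (noiseCorr (fun i => (Y i ω).1) (fun i => p i ω) θ (fun i => h (Y i ω) (A i ω)) t)
        (θ ⬝ᵥ ((Y t ω).1 *ᵥ p t ω)) hω.1 hω.2
      have h2 := mul_le_mul_of_nonneg_left h1 (div_nonneg (selfNormExp_nonneg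
        (fun i => (Y i ω).1) (fun i => p i ω) θ (fun i => h (Y i ω) (A i ω)) t)
        (Real.sqrt_nonneg (1 + width (fun i => (Y i ω).1) (fun i => p i ω) t)))
      rw [selfNormExp_succ]
      refine h2.trans (le_of_eq ?_)
      simp only [Pi.mul_apply, Pi.div_apply, Pi.neg_apply]
      ring
    · have hw := width_nonneg (fun i => (Y i ω).1) (fun i => p i ω) t
      have h1 := growth_mean_le hω.1 hω.2 hw
        (noiseCorr (fun i => (Y i ω).1) (fun i => p i ω) θ (fun i => h (Y i ω) (A i ω)) t)
      have hs0 : 0 < √(1 + width (fun i => (Y i ω).1) (fun i => p i ω) t) :=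
        Real.sqrt_pos.2 (by linarith)
      have h2 := mul_le_mul_of_nonneg_left h1 (div_nonneg (selfNormExp_nonneg
        (fun i => (Y i ω).1) (fun i => p i ω) θ (fun i => h (Y i ω) (A i ω)) t) hs0.le)
      rw [div_mul_cancel₀ _ hs0.ne'] at h2
      refine le_trans (le_of_eq ?_) h2
      simp only [Pi.mul_apply, Pi.div_apply, Pi.neg_apply]
      ring

end Exploration

/-! ### Concentration -/

section Concentration

variable {Ω : Type*} {mΩ : MeasurableSpace Ω} {P : Measure Ω}
  {D : Measure (Outcome m K d)} {T₀ : ℕ} {ℱ : Filtration ℕ mΩ}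
  {Y : ℕ → Ω → Outcome m K d} {p : ℕ → Ω → Fin K → ℝ} {A : ℕ → Ω → Fin K}
  {h : Outcome m K d → Fin K → ℝ} {θ : Fin m → ℝ} {t : ℕ}

theorem measure_exp_lt_le {Q : Ω → ℝ} (hQ : Measurable Q)
    (h : ∫⁻ ω, ENNReal.ofReal (Q ω) ∂P ≤ 1) (L : ℝ) :
    P {ω | Real.exp L < Q ω} ≤ ENNReal.ofReal (Real.exp (-L)) := by
  have hpos : ENNReal.ofReal (Real.exp L) ≠ 0 := by simp [Real.exp_pos]
  calc P {ω | Real.exp L < Q ω}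
      ≤ P {ω | ENNReal.ofReal (Real.exp L) ≤ ENNReal.ofReal (Q ω)} :=
        measure_mono fun ω hω => ENNReal.ofReal_le_ofReal (le_of_lt hω)
    _ ≤ (∫⁻ ω, ENNReal.ofReal (Q ω) ∂P) / ENNReal.ofReal (Real.exp L) :=
        meas_ge_le_lintegral_div hQ.ennreal_ofReal.aemeasurable hpos ENNReal.ofReal_ne_top
    _ ≤ 1 / ENNReal.ofReal (Real.exp L) := by gcongr
    _ = ENNReal.ofReal (Real.exp (-L)) := by
        rw [Real.exp_neg, ENNReal.ofReal_inv_of_pos (Real.exp_pos L), one_div]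

variable [IsProbabilityMeasure P]

/-- The exponential supermartingale behind Hoeffding's inequality, again through the chord of the
exponential. -/
theorem IsExploration.lintegral_exp_sum_le (hE : IsExploration P D T₀ ℱ Y p A)
    {f : Outcome m K d → ℝ} (hf : Measurable f) (hf01 : ∀ᵐ y ∂D, f y ∈ Set.Icc (0 : ℝ) 1)
    (s : ℝ) (ht : t ≤ T₀) :
    ∫⁻ ω, ENNReal.ofReal (Real.exp (s * ∑ i ∈ Finset.range t, (f (Y i ω) - ∫ y, f y ∂D)
      - t * (s ^ 2 / 8))) ∂P ≤ 1 := by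
  induction t with
  | zero => simp
  | succ t ih =>
    have ht' : t < T₀ := ht
    refine le_trans ?_ (ih ht'.le)
    set c := ∫ y, f y ∂D with hc
    set Q : Ω → ℝ := fun ω => Real.exp (s * ∑ i ∈ Finset.range t, (f (Y i ω) - c)
      - t * (s ^ 2 / 8)) with hQdef
    have hY := hE.measurable_outcome ht'
    have hQ : Measurable[ℱ t] Q := by
      refine Real.measurable_exp.comp (((Finset.measurable_sum _ fun i hi => ?_).const_mul
        s).sub_const _)
      have hi := Finset.mem_range.1 hi
      exact (hf.comp ((hE.outcome_adapted i (hi.trans ht')).mono (ℱ.mono hi) le_rfl)).sub_const c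
    have hr01 : ∀ᵐ ω ∂P, f (Y t ω) ∈ Set.Icc (0 : ℝ) 1 := hE.ae_outcome ht' hf01
    have hmean : ∫ ω, f (Y t ω) ∂P = c := by
      rw [hc, ← hE.outcome_law t ht', integral_map hY.aemeasurable hf.aestronglyMeasurable]
    have hcond : P[fun ω => f (Y t ω) | ℱ t] =ᵐ[P] fun _ => c := by
      rw [← hmean]
      exact condExp_indep_eq (hE.comap_outcome_le ht') (ℱ.le t)
        (hf.comp (comap_measurable (Y t))).stronglyMeasurable (hE.outcome_indep t ht')
    refine lintegral_le_of_chord (ℱ.le t) (integrable_of_mem_Icc (hf.comp hY) hr01) hr01 hcond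
      (w₀ := fun ω => Q ω * (Real.exp (-c * s) * Real.exp (-(s ^ 2 / 8))))
      (w₁ := fun ω => Q ω * (Real.exp ((1 - c) * s) * Real.exp (-(s ^ 2 / 8))))
      (hQ.mul_const _) (hQ.mul_const _) (fun ω => by positivity) (fun ω => by positivity)
      (hr01.mono fun ω hω => ?_) (ae_of_all _ fun ω hω => ?_)
    · have hconv := convexOn_exp.2 (Set.mem_univ (-c * s)) (Set.mem_univ ((1 - c) * s))
        (sub_nonneg.2 hω.2) hω.1 (by ring)
      simp only [smul_eq_mul] at hconv
      have e : Real.exp (s * ∑ i ∈ Finset.range (t + 1), (f (Y i ω) - c)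
          - (t + 1 : ℕ) * (s ^ 2 / 8)) = Q ω * Real.exp (-(s ^ 2 / 8)) *
          Real.exp ((1 - f (Y t ω)) * (-c * s) + f (Y t ω) * ((1 - c) * s)) := by
        rw [hQdef, ← Real.exp_add, ← Real.exp_add, Finset.sum_range_succ]
        congr 1
        push_cast
        ring
      rw [e]
      refine (mul_le_mul_of_nonneg_left hconv (by positivity)).trans (le_of_eq ?_)
      simp only [Function.comp_apply]
      ring
    · have hb := bernoulli_centered_mgf_le hω.1 hω.2 s
      have hQ0 : 0 ≤ Q ω * Real.exp (-(s ^ 2 / 8)) := by positivity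
      have h1 := mul_le_mul_of_nonneg_left hb hQ0
      have h2 : Q ω * Real.exp (-(s ^ 2 / 8)) * Real.exp (s ^ 2 / 8) = Q ω := by
        rw [mul_assoc, ← Real.exp_add]
        simp
      rw [h2] at h1
      refine le_trans (le_of_eq ?_) h1
      ring

/-- Hoeffding's inequality for a bounded function of the outcomes. -/
theorem IsExploration.measure_sum_gt_le (hE : IsExploration P D T₀ ℱ Y p A)
    {f : Outcome m K d → ℝ} (hf : Measurable f) (hf01 : ∀ᵐ y ∂D, f y ∈ Set.Icc (0 : ℝ) 1)
    (hT : 0 < T₀) {L : ℝ} (hL : 0 ≤ L) :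
    P {ω | T₀ * ∫ y, f y ∂D + √(T₀ * L / 2) < ∑ i ∈ Finset.range T₀, f (Y i ω)}
      ≤ ENNReal.ofReal (Real.exp (-L)) := by
  rcases hL.eq_or_lt with rfl | hL
  · simpa using prob_le_one
  have hT' : (0 : ℝ) < T₀ := by exact_mod_cast hT
  set c := ∫ y, f y ∂D with hc
  set ε := √(T₀ * L / 2) with hε
  have hε2 : ε ^ 2 = T₀ * L / 2 := Real.sq_sqrt (by positivity)
  have hε0 : 0 < ε := Real.sqrt_pos.2 (by positivity)
  -- The optimal Chernoff parameter, for which the exponent equals `2 * ε ^ 2 / T₀ = L`.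
  set s := 4 * ε / T₀ with hs
  have hmeas : Measurable fun ω => Real.exp (s * ∑ i ∈ Finset.range T₀, (f (Y i ω) - c)
      - T₀ * (s ^ 2 / 8)) :=
    Real.measurable_exp.comp (((Finset.measurable_sum _ fun i hi =>
      (hf.comp (hE.measurable_outcome (Finset.mem_range.1 hi))).sub_const c).const_mul
        s).sub_const _)
  refine (measure_mono fun ω hω => ?_).trans
    (measure_exp_lt_le hmeas (hE.lintegral_exp_sum_le hf hf01 s le_rfl) L)
  simp only [Set.mem_ofPred_eq, Real.exp_lt_exp] at hω ⊢
  rw [Finset.sum_sub_distrib, Finset.sum_const, Finset.card_range, nsmul_eq_mul]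
  have hs0 : 0 < s := by positivity
  have h1 : s * ε < s * (∑ i ∈ Finset.range T₀, f (Y i ω) - T₀ * c) :=
    mul_lt_mul_of_pos_left (by linarith) hs0
  have h2 : s * ε - T₀ * (s ^ 2 / 8) = L := by
    rw [hs, div_pow, mul_pow, hε2, show 4 * ε / T₀ * ε = 4 * ε ^ 2 / T₀ by ring, hε2]
    field_simp
    ring
  linarith

variable [IsProbabilityMeasure D]

/-- With high probability the self-normalized process stays bounded during the exploration. -/
theorem IsExploration.measure_selfNormExp_gt_le (hE : IsExploration P D T₀ ℱ Y p A)
    (hs : IsSignal D h θ) (L : ℝ) :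
    P {ω | ∃ t < T₀, Real.exp L < selfNormExp (fun i => (Y i ω).1) (fun i => p i ω) θ
      (fun i => h (Y i ω) (A i ω)) t} ≤ T₀ * ENNReal.ofReal (Real.exp (-L)) := by
  have hsub : {ω | ∃ t < T₀, Real.exp L < selfNormExp (fun i => (Y i ω).1) (fun i => p i ω) θ
      (fun i => h (Y i ω) (A i ω)) t} ⊆ ⋃ t ∈ Finset.range T₀,
        {ω | Real.exp L < selfNormExp (fun i => (Y i ω).1) (fun i => p i ω) θ
      (fun i => h (Y i ω) (A i ω)) t} := by
    rintro ω ⟨t, ht, hω⟩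
    exact Set.mem_biUnion (Finset.mem_coe.2 (Finset.mem_range.2 ht)) hω
  refine (measure_mono hsub).trans ((measure_biUnion_finset_le _ _).trans ?_)
  refine (Finset.sum_le_card_nsmul _ _ (ENNReal.ofReal (Real.exp (-L))) fun t ht => ?_).trans ?_
  · have ht := (Finset.mem_range.1 ht).le
    exact measure_exp_lt_le ((measurable_selfNormExp (hE.measurable_context_hist ht)
      (hE.measurable_choice_hist ht) (hE.measurable_obs_hist hs.measurable ht) θ).mono
      (ℱ.le t) le_rfl) (hE.lintegral_selfNormExp_le hs ht) L
  · simp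

end Concentration

/-! ### Policies -/

/-- The information carried by the contexts. -/
abbrev contextInfo (m K d : ℕ) : MeasurableSpace (Outcome m K d) :=
  MeasurableSpace.comap Prod.fst inferInstance

section Policies

theorem Policy.arms_nonneg (π : Policy m K) (X : Context m K) (a : Fin K) : 0 ≤ π.arms X a :=
  (π.mem_simplex X).1 _

theorem Policy.sum_arms_le (π : Policy m K) (X : Context m K) : ∑ a, π.arms X a ≤ 1 := by
  have h := (π.mem_simplex X).2
  rw [Fintype.sum_option] at h
  have h0 := (π.mem_simplex X).1 none
  unfold Policy.arms
  linarith

theorem Policy.arms_le_one (π : Policy m K) (X : Context m K) (a : Fin K) : π.arms X a ≤ 1 :=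
  (Finset.single_le_sum (fun b _ => π.arms_nonneg X b) (Finset.mem_univ a)).trans
    (π.sum_arms_le X)

theorem Policy.measurable_arms (π : Policy m K) : Measurable π.arms :=
  measurable_pi_lambda _ fun a => (measurable_pi_apply (some a)).comp π.measurable_toFun

theorem dotProduct_arms_mem (π : Policy m K) (X : Context m K) {c : Fin K → ℝ}
    (hc : ∀ a, c a ∈ Set.Icc (0 : ℝ) 1) : c ⬝ᵥ π.arms X ∈ Set.Icc (0 : ℝ) 1 := by
  refine ⟨Finset.sum_nonneg fun a _ => mul_nonneg (hc a).1 (π.arms_nonneg X a), ?_⟩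
  refine (Finset.sum_le_sum fun a _ => ?_).trans (π.sum_arms_le X)
  exact mul_le_of_le_one_left (π.arms_nonneg X a) (hc a).2

/-- The policy that always plays the no-op. -/
def Policy.noop (m K : ℕ) : Policy m K where
  toFun _ := Pi.single none 1
  measurable_toFun := measurable_const
  mem_simplex _ := single_mem_stdSimplex ℝ none

theorem Policy.noop_arms (X : Context m K) : (Policy.noop m K).arms X = 0 := by
  ext a
  simp [Policy.arms, Policy.noop]

variable {D : Measure (Outcome m K d)} {h : Outcome m K d → Fin K → ℝ} {θ : Fin m → ℝ}

theorem IsSignal.measurable_value (hs : IsSignal D h θ) (π : Policy m K) :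
    Measurable fun y => h y ⬝ᵥ π.arms y.1 :=
  measurable_dotProduct hs.measurable (π.measurable_arms.comp measurable_fst)

theorem measurable_meanValue (θ : Fin m → ℝ) (π : Policy m K) :
    Measurable fun X : Context m K => θ ⬝ᵥ (X *ᵥ π.arms X) :=
  measurable_dotProduct measurable_const (measurable_mulVec measurable_id π.measurable_arms)

theorem IsSignal.value_mem (hs : IsSignal D h θ) (π : Policy m K) :
    ∀ᵐ y ∂D, h y ⬝ᵥ π.arms y.1 ∈ Set.Icc (0 : ℝ) 1 :=
  hs.mem.mono fun y hy => dotProduct_arms_mem π y.1 hy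

variable [IsProbabilityMeasure D]

theorem IsSignal.meanValue_mem (hs : IsSignal D h θ) (π : Policy m K) :
    ∀ᵐ y ∂D, θ ⬝ᵥ (y.1 *ᵥ π.arms y.1) ∈ Set.Icc (0 : ℝ) 1 := by
  refine hs.mean_mem.mono fun y hy => ?_
  rw [Matrix.dotProduct_mulVec]
  exact dotProduct_arms_mem π y.1 hy

theorem IsSignal.integrable_value (hs : IsSignal D h θ) (π : Policy m K) :
    Integrable (fun y => h y ⬝ᵥ π.arms y.1) D :=
  integrable_of_mem_Icc (hs.measurable_value π) (hs.value_mem π)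

theorem IsSignal.integrable_meanValue (hs : IsSignal D h θ) (π : Policy m K) :
    Integrable (fun y => θ ⬝ᵥ (y.1 *ᵥ π.arms y.1)) D :=
  integrable_of_mem_Icc ((measurable_meanValue θ π).comp measurable_fst) (hs.meanValue_mem π)

theorem IsSignal.integral_value_mem (hs : IsSignal D h θ) (π : Policy m K) :
    ∫ y, h y ⬝ᵥ π.arms y.1 ∂D ∈ Set.Icc (0 : ℝ) 1 := by
  refine ⟨integral_nonneg_of_ae ((hs.value_mem π).mono fun y hy => hy.1), ?_⟩
  have := integral_mono_ae (hs.integrable_value π) (integrable_const 1)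
    ((hs.value_mem π).mono fun y hy => hy.2)
  simpa using this

/-- The arm probabilities depend on the contexts only, so they come out of the conditional
expectation. -/
theorem IsSignal.integral_value_eq (hs : IsSignal D h θ) (π : Policy m K) :
    ∫ y, h y ⬝ᵥ π.arms y.1 ∂D = ∫ y, θ ⬝ᵥ (y.1 *ᵥ π.arms y.1) ∂D := by
  have harm : ∀ a, Measurable[contextInfo m K d] fun y : Outcome m K d => π.arms y.1 a := fun a =>
    (measurable_coord π.measurable_arms a).comp (comap_measurable Prod.fst)
  have hbd : ∀ a, ∀ᵐ y ∂D, ‖π.arms y.1 a‖ ≤ 1 := fun a => ae_of_all _ fun y => by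
    rw [Real.norm_eq_abs, abs_of_nonneg (π.arms_nonneg _ a)]
    exact π.arms_le_one _ a
  have hterm : ∀ a, D[fun y => π.arms y.1 a * h y a | contextInfo m K d]
      =ᵐ[D] fun y => π.arms y.1 a * (θ ᵥ* y.1) a := by
    intro a
    filter_upwards [condExp_stronglyMeasurable_mul_of_bound comap_fst_le (harm a).stronglyMeasurable
      (hs.integrable a) 1 (hbd a), hs.linear a] with y h1 h2
    refine h1.trans ?_
    rw [Pi.mul_apply, h2]
  have hint : ∀ a, Integrable (fun y => π.arms y.1 a * h y a) D := fun a =>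
    (hs.integrable a).bdd_mul ((harm a).mono comap_fst_le le_rfl).aestronglyMeasurable (hbd a)
  have hint' : ∀ a, Integrable (fun y => π.arms y.1 a * (θ ᵥ* y.1) a) D := fun a =>
    integrable_condExp.congr (hterm a)
  have e1 : ∀ y, h y ⬝ᵥ π.arms y.1 = ∑ a, π.arms y.1 a * h y a := fun y => by
    simp [dotProduct, mul_comm]
  have e2 : ∀ y : Outcome m K d,
      θ ⬝ᵥ (y.1 *ᵥ π.arms y.1) = ∑ a, π.arms y.1 a * (θ ᵥ* y.1) a := fun y => by
    rw [Matrix.dotProduct_mulVec]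
    simp [dotProduct, mul_comm]
  simp_rw [e1, e2]
  rw [integral_finsetSum _ fun a _ => hint a, integral_finsetSum _ fun a _ => hint' a]
  refine Finset.sum_congr rfl fun a _ => ?_
  rw [← integral_condExp comap_fst_le, integral_congr_ae (hterm a)]

end Policies

/-! ### Linear programming duality for static policies -/

section Duality

/-- The mixture of two policies. -/
def Policy.mix (π₁ π₂ : Policy m K) (s t : ℝ) (hs : 0 ≤ s) (ht : 0 ≤ t) (hst : s + t = 1) :
    Policy m K where
  toFun X := s • π₁.toFun X + t • π₂.toFun X
  measurable_toFun := (π₁.measurable_toFun.const_smul s).add (π₂.measurable_toFun.const_smul t)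
  mem_simplex X := convex_stdSimplex ℝ _ (π₁.mem_simplex X) (π₂.mem_simplex X) hs ht hst

variable {D : Measure (Outcome m K d)} {μ : Fin m → ℝ} {W : Matrix (Fin m) (Fin d) ℝ}
  {h : Outcome m K d → Fin K → ℝ} {θ : Fin m → ℝ}

theorem integral_value_mix [IsProbabilityMeasure D] (hsig : IsSignal D h θ) (π₁ π₂ : Policy m K)
    {s t : ℝ} (hs : 0 ≤ s) (ht : 0 ≤ t) (hst : s + t = 1) :
    ∫ y, h y ⬝ᵥ (π₁.mix π₂ s t hs ht hst).arms y.1 ∂D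
      = s * ∫ y, h y ⬝ᵥ π₁.arms y.1 ∂D + t * ∫ y, h y ⬝ᵥ π₂.arms y.1 ∂D := by
  rw [← integral_const_mul, ← integral_const_mul,
    ← integral_add ((hsig.integrable_value π₁).const_mul s)
      ((hsig.integrable_value π₂).const_mul t)]
  refine integral_congr_ae (ae_of_all _ fun y => ?_)
  have e : (π₁.mix π₂ s t hs ht hst).arms y.1 = s • π₁.arms y.1 + t • π₂.arms y.1 := rfl
  simp only [e, dotProduct_add, dotProduct_smul, smul_eq_mul]

theorem expReward_noop : expReward D (Policy.noop m K) = 0 := by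
  simp [expReward, Policy.noop_arms]

theorem expConsumption_noop (j : Fin d) : expConsumption D (Policy.noop m K) j = 0 := by
  simp [expConsumption, Policy.noop_arms]

variable {T : ℕ} {B : ℝ}

theorem IsInstance.bddAbove_values (hD : IsInstance D μ W) :
    BddAbove {v | ∃ π : Policy m K, (∀ j, T * expConsumption D π j ≤ B) ∧
      v = T * expReward D π} := by
  have := hD.prob
  refine ⟨T, ?_⟩
  rintro _ ⟨π, -, rfl⟩
  exact mul_le_of_le_one_right (Nat.cast_nonneg T) (hD.isSignal_reward.integral_value_mem π).2

theorem IsInstance.le_OPT (hD : IsInstance D μ W) {π : Policy m K}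
    (hπ : ∀ j, T * expConsumption D π j ≤ B) : T * expReward D π ≤ OPT D T B :=
  le_csSup hD.bddAbove_values ⟨π, hπ, rfl⟩

theorem IsInstance.OPT_nonneg (hD : IsInstance D μ W) (hB : 0 ≤ B) : 0 ≤ OPT D T B := by
  have h := hD.le_OPT (T := T) (B := B) (π := Policy.noop m K)
    (fun j => by simpa [expConsumption_noop] using hB)
  simpa [expReward_noop] using h

theorem exists_policy_gt (hB : 0 ≤ B) {c : ℝ} (hc : c < OPT D T B) :
    ∃ π : Policy m K, (∀ j, T * expConsumption D π j ≤ B) ∧ c < T * expReward D π := by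
  have hne : {v | ∃ π : Policy m K, (∀ j, T * expConsumption D π j ≤ B) ∧
      v = T * expReward D π}.Nonempty :=
    ⟨_, Policy.noop m K, fun j => by simpa [expConsumption_noop] using hB, rfl⟩
  obtain ⟨_, ⟨π, hπ, rfl⟩, h⟩ := exists_lt_of_lt_csSup hne hc
  exact ⟨π, hπ, h⟩

theorem nonneg_of_forall_le_mul {u c : ℝ} (h : ∀ n : ℝ, 0 ≤ n → u ≤ n * c) : 0 ≤ c := by
  by_contra! hc
  have h1 := h ((|u| + 1) / -c) (div_nonneg (by positivity) (by linarith))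
  rw [div_mul_eq_mul_div, le_div_iff₀ (by linarith)] at h1
  have h2 := neg_abs_le u
  nlinarith

/-- The supergradient inequality: optimal dual prices of the resources. -/
theorem IsInstance.exists_dual_prices (hD : IsInstance D μ W) (T : ℕ) (hB : 0 < B) :
    ∃ c : Fin d → ℝ, (∀ j, 0 ≤ c j) ∧ ∀ π : Policy m K,
      T * expReward D π + ∑ j, c j * (B - T * expConsumption D π j) ≤ OPT D T B := by
  have := hD.prob
  -- Points better than the optimum are separated from the attainable pairs of reward and
  -- consumption. Openness of `U` yields the separation even if no policy attains the supremum.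
  set U : Set (ℝ × (Fin d → ℝ)) := {z | OPT D T B < z.1 ∧ ∀ j, z.2 j < B} with hU
  set S : Set (ℝ × (Fin d → ℝ)) := {z | ∃ π : Policy m K, z.1 ≤ T * expReward D π ∧
    ∀ j, T * expConsumption D π j ≤ z.2 j} with hS
  have hUo : IsOpen U := by
    have h1 : IsOpen {z : ℝ × (Fin d → ℝ) | OPT D T B < z.1} :=
      isOpen_lt continuous_const continuous_fst
    have h2 : IsOpen {z : ℝ × (Fin d → ℝ) | ∀ j, z.2 j < B} := by
      rw [show {z : ℝ × (Fin d → ℝ) | ∀ j, z.2 j < B} = ⋂ j, {z | z.2 j < B} by ext z; simp]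
      exact isOpen_iInter_of_finite fun j =>
        isOpen_lt ((continuous_apply j).comp continuous_snd) continuous_const
    exact h1.inter h2
  have hUc : Convex ℝ U := by
    rintro x ⟨hx1, hx2⟩ y ⟨hy1, hy2⟩ s t hs ht hst
    refine ⟨?_, fun j => ?_⟩
    · exact convex_Ioi (OPT D T B) (Set.mem_Ioi.2 hx1) (Set.mem_Ioi.2 hy1) hs ht hst
    · exact convex_Iio B (Set.mem_Iio.2 (hx2 j)) (Set.mem_Iio.2 (hy2 j)) hs ht hst
  have hSc : Convex ℝ S := by
    rintro x ⟨π₁, hx1, hx2⟩ y ⟨π₂, hy1, hy2⟩ s t hs ht hst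
    refine ⟨π₁.mix π₂ s t hs ht hst, ?_, fun j => ?_⟩
    · have e : expReward D (π₁.mix π₂ s t hs ht hst)
          = s * expReward D π₁ + t * expReward D π₂ :=
        integral_value_mix hD.isSignal_reward π₁ π₂ hs ht hst
      have h1 := mul_le_mul_of_nonneg_left hx1 hs
      have h2 := mul_le_mul_of_nonneg_left hy1 ht
      rw [e]
      simp only [Prod.fst_add, Prod.smul_fst, smul_eq_mul]
      linarith
    · have e : expConsumption D (π₁.mix π₂ s t hs ht hst) j
          = s * expConsumption D π₁ j + t * expConsumption D π₂ j :=
        integral_value_mix (hD.isSignal_consumption j) π₁ π₂ hs ht hst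
      have h1 := mul_le_mul_of_nonneg_left (hx2 j) hs
      have h2 := mul_le_mul_of_nonneg_left (hy2 j) ht
      rw [e]
      simp only [Prod.snd_add, Prod.smul_snd, Pi.add_apply, Pi.smul_apply, smul_eq_mul]
      linarith
  have hdisj : Disjoint U S := by
    rw [Set.disjoint_left]
    rintro z ⟨hz1, hz2⟩ ⟨π, hπ1, hπ2⟩
    have := hD.le_OPT fun j => (hπ2 j).trans (hz2 j).le
    linarith
  obtain ⟨f, u, hfU, hfS⟩ := geometric_hahn_banach_open hUc hUo hSc hdisj
  set α := f (1, 0) with hα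
  set l : Fin d → ℝ := fun j => f (0, Pi.single j 1) with hl
  have hf : ∀ (s : ℝ) (v : Fin d → ℝ), f (s, v) = s * α + ∑ j, v j * l j := by
    intro s v
    have e : ((s, v) : ℝ × (Fin d → ℝ)) = s • ((1, 0) : ℝ × (Fin d → ℝ))
        + ∑ j, v j • ((0, Pi.single j 1) : ℝ × (Fin d → ℝ)) := by
      refine Prod.ext ?_ ?_
      · simp [Prod.fst_sum]
      · ext j
        simp [Prod.snd_sum, Finset.sum_apply, Pi.single_apply]
    rw [e, map_add, map_smul, map_sum]
    simp only [map_smul, smul_eq_mul, hα, hl]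
  have hnoop : ∀ (s : ℝ) (v : Fin d → ℝ), s ≤ 0 → (∀ j, 0 ≤ v j) → u ≤ f (s, v) :=
    fun s v hs hv => hfS _ ⟨Policy.noop m K, by simpa [expReward_noop] using hs,
      fun j => by simpa [expConsumption_noop] using hv j⟩
  -- The attainable set is closed under raising consumption and lowering reward, which fixes the
  -- signs of the functional.
  have hl0 : ∀ j, 0 ≤ l j := fun j => nonneg_of_forall_le_mul (u := u) fun n hn => by
    have h1 := hnoop 0 (Pi.single j n) le_rfl fun i => by
      by_cases hij : i = j <;> simp [hij, hn]
    rw [hf] at h1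
    simpa [Pi.single_apply] using h1
  have hα0 : 0 ≤ -α := nonneg_of_forall_le_mul (u := u) fun n hn => by
    have h1 := hnoop (-n) 0 (by linarith) fun i => le_rfl
    rw [hf] at h1
    simpa using h1
  have hsum0 : 0 ≤ ∑ j, l j := Finset.sum_nonneg fun j _ => hl0 j
  have hlt : ∀ ε > 0, (OPT D T B + ε) * α + (B - ε) * ∑ j, l j < u := by
    intro ε hε
    have h1 := hfU (OPT D T B + ε, fun _ => B - ε) ⟨by simpa using hε, fun j => by simpa using hε⟩
    rwa [hf, ← Finset.mul_sum] at h1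
  -- Slater's condition: the no-op consumes nothing and `0 < B`, so the separating hyperplane is not
  -- vertical and division by `-α` is possible.
  have hα1 : 0 < -α := by
    refine lt_of_le_of_ne hα0 fun h0 => ?_
    have h1 := hlt (B / 2) (by positivity)
    have h2 := hnoop 0 0 le_rfl fun _ => le_rfl
    rw [hf] at h2
    simp only [Pi.zero_apply, zero_mul, Finset.sum_const_zero, add_zero] at h2
    have h3 : α = 0 := by linarith
    rw [h3] at h1
    nlinarith
  have hlim : OPT D T B * α + B * ∑ j, l j ≤ u := by
    refine le_of_forall_pos_le_add fun ε hε => ?_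
    have hpos : 0 < ∑ j, l j - α := by linarith
    have h1 := hlt (ε / (∑ j, l j - α)) (by positivity)
    have h2 : ε / (∑ j, l j - α) * (∑ j, l j - α) = ε := div_mul_cancel₀ _ hpos.ne'
    nlinarith
  refine ⟨fun j => l j / -α, fun j => div_nonneg (hl0 j) hα0, fun π => ?_⟩
  have h1 := hfS (T * expReward D π, fun j => T * expConsumption D π j) ⟨π, le_rfl, fun j => le_rfl⟩
  rw [hf] at h1
  have h2 : ∑ j, l j / -α * (B - T * expConsumption D π j)
      = (B * ∑ j, l j - ∑ j, T * expConsumption D π j * l j) / -α := by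
    rw [Finset.mul_sum, ← Finset.sum_sub_distrib, Finset.sum_div]
    refine Finset.sum_congr rfl fun j _ => ?_
    ring
  rw [h2, ← le_sub_iff_add_le', div_le_iff₀ hα1]
  linarith

end Duality

/-! ### Greedy policies -/

section Greedy

variable (ρ : Fin m → ℝ)

/-- The score `ρᵀ x(a)` of an arm, with score `0` for the no-op. -/
def score (X : Context m K) (o : Option (Fin K)) : ℝ := o.elim 0 (ρ ᵥ* X)

/-- The best score of the arms and the no-op. -/
def bestScore (X : Context m K) : ℝ :=
  Finset.univ.sup' Finset.univ_nonempty (score ρ X)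

theorem score_le_bestScore (X : Context m K) (o : Option (Fin K)) :
    score ρ X o ≤ bestScore ρ X := Finset.le_sup' _ (Finset.mem_univ o)

theorem exists_score_eq (X : Context m K) : ∃ o, score ρ X o = bestScore ρ X := by
  obtain ⟨o, -, ho⟩ := Finset.exists_mem_eq_sup' (s := Finset.univ)
    Finset.univ_nonempty (score ρ X)
  exact ⟨o, ho.symm⟩

theorem measurable_score (o : Option (Fin K)) : Measurable fun X : Context m K => score ρ X o := by
  cases o with
  | none => exact measurable_const
  | some a => exact measurable_mean ρ a

theorem measurable_bestScore : Measurable (bestScore ρ : Context m K → ℝ) := by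
  have h := Finset.measurable_sup' (s := (Finset.univ : Finset (Option (Fin K))))
    Finset.univ_nonempty (f := fun o (X : Context m K) => score ρ X o)
    fun o _ => measurable_score ρ o
  convert h using 1
  ext X
  exact (Finset.sup'_apply Finset.univ_nonempty (fun o (X : Context m K) => score ρ X o) X).symm

theorem bestScore_nonneg (X : Context m K) : 0 ≤ bestScore ρ X := score_le_bestScore ρ X none

theorem dotProduct_arms_eq (π : Policy m K) (X : Context m K) :
    ρ ⬝ᵥ (X *ᵥ π.arms X) = ∑ o, score ρ X o * π.toFun X o := by
  rw [Matrix.dotProduct_mulVec, Fintype.sum_option]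
  simp [score, dotProduct, Policy.arms]

theorem dotProduct_arms_le_bestScore (π : Policy m K) (X : Context m K) :
    ρ ⬝ᵥ (X *ᵥ π.arms X) ≤ bestScore ρ X := by
  rw [dotProduct_arms_eq]
  calc ∑ o, score ρ X o * π.toFun X o ≤ ∑ o, bestScore ρ X * π.toFun X o :=
        Finset.sum_le_sum fun o _ =>
          mul_le_mul_of_nonneg_right (score_le_bestScore ρ X o) ((π.mem_simplex X).1 o)
    _ = bestScore ρ X := by rw [← Finset.mul_sum, (π.mem_simplex X).2, mul_one]

/-- The indicator of the options of best score. -/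
def bestIndicator (X : Context m K) (o : Option (Fin K)) : ℝ :=
  if score ρ X o = bestScore ρ X then 1 else 0

theorem bestIndicator_nonneg (X : Context m K) (o : Option (Fin K)) :
    0 ≤ bestIndicator ρ X o := by
  unfold bestIndicator
  split_ifs <;> simp

theorem sum_bestIndicator_pos (X : Context m K) : 0 < ∑ o, bestIndicator ρ X o := by
  obtain ⟨o, ho⟩ := exists_score_eq ρ X
  refine Finset.sum_pos' (fun o _ => bestIndicator_nonneg ρ X o) ⟨o, Finset.mem_univ o, ?_⟩
  simp [bestIndicator, ho]

theorem measurable_bestIndicator (o : Option (Fin K)) :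
    Measurable fun X : Context m K => bestIndicator ρ X o :=
  Measurable.ite (measurableSet_eq_fun (measurable_score ρ o) (measurable_bestScore ρ))
    measurable_const measurable_const

/-- The policy that draws uniformly among the options of best score. -/
def greedy : Policy m K where
  -- Splitting ties evenly gives measurability without a measurable selection.
  toFun X o := bestIndicator ρ X o / ∑ o', bestIndicator ρ X o'
  measurable_toFun := measurable_pi_lambda _ fun o => (measurable_bestIndicator ρ o).div
    (Finset.measurable_sum _ fun o' _ => measurable_bestIndicator ρ o')
  mem_simplex X := ⟨fun o => div_nonneg (bestIndicator_nonneg ρ X o)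
    (sum_bestIndicator_pos ρ X).le, by
      rw [← Finset.sum_div, div_self (sum_bestIndicator_pos ρ X).ne']⟩

theorem dotProduct_greedy_arms (X : Context m K) :
    ρ ⬝ᵥ (X *ᵥ (greedy ρ).arms X) = bestScore ρ X := by
  rw [dotProduct_arms_eq]
  have h : ∀ o, score ρ X o * (greedy ρ).toFun X o
      = bestScore ρ X * (greedy ρ).toFun X o := by
    intro o
    by_cases ho : score ρ X o = bestScore ρ X
    · rw [ho]
    · simp [greedy, bestIndicator, ho]
  rw [Finset.sum_congr rfl fun o _ => h o, ← Finset.mul_sum, ((greedy ρ).mem_simplex X).2, mul_one]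

end Greedy

/-! ### The Lagrangian score at the dual prices -/

section Lagrangian

/-- The parameter `μ - W c` of the Lagrangian at the prices `c`. -/
def lagrangian (μ : Fin m → ℝ) (W : Matrix (Fin m) (Fin d) ℝ) (c : Fin d → ℝ) : Fin m → ℝ :=
  fun l => μ l - ∑ j, c j * W l j

variable {D : Measure (Outcome m K d)} {μ : Fin m → ℝ} {W : Matrix (Fin m) (Fin d) ℝ}
  {c : Fin d → ℝ}

theorem lagrangian_dotProduct (x : Fin m → ℝ) :
    lagrangian μ W c ⬝ᵥ x = μ ⬝ᵥ x - ∑ j, c j * ((fun l => W l j) ⬝ᵥ x) := by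
  simp only [lagrangian, dotProduct, sub_mul, Finset.sum_sub_distrib, Finset.sum_mul,
    Finset.mul_sum]
  rw [Finset.sum_comm]
  simp only [mul_assoc]

/-- The no-op gives the lower bound, and nonnegative prices only lower a score below the mean
reward. The range does not depend on the size of the prices, so neither does the Hoeffding bound. -/
theorem IsInstance.bestScore_mem (hD : IsInstance D μ W) (hc : ∀ j, 0 ≤ c j) :
    ∀ᵐ y ∂D, bestScore (lagrangian μ W c) y.1 ∈ Set.Icc (0 : ℝ) 1 := by
  have := hD.prob
  filter_upwards [hD.isSignal_reward.mean_mem,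
    ae_all_iff.2 fun j => (hD.isSignal_consumption j).mean_mem] with y h1 h2
  refine ⟨bestScore_nonneg _ _, ?_⟩
  obtain ⟨o, ho⟩ := exists_score_eq (lagrangian μ W c) y.1
  rw [← ho]
  cases o with
  | none => simp [score]
  | some a =>
    have e : score (lagrangian μ W c) y.1 (some a)
        = (μ ᵥ* y.1) a - ∑ j, c j * ((fun l => W l j) ᵥ* y.1) a :=
      lagrangian_dotProduct fun l => y.1 l a
    have h3 : 0 ≤ ∑ j, c j * ((fun l => W l j) ᵥ* y.1) a :=
      Finset.sum_nonneg fun j _ => mul_nonneg (hc j) (h2 j a).1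
    rw [e]
    linarith [(h1 a).2]

/-- The Lagrangian bound on the best score, from the dual prices. -/
theorem IsInstance.exists_prices_bestScore (hD : IsInstance D μ W) (T : ℕ) {B : ℝ} (hB : 0 < B) :
    ∃ c : Fin d → ℝ, (∀ j, 0 ≤ c j) ∧
      T * ∫ y, bestScore (lagrangian μ W c) y.1 ∂D + B * ∑ j, c j ≤ OPT D T B := by
  have := hD.prob
  obtain ⟨c, hc, h⟩ := hD.exists_dual_prices T hB
  -- The greedy policy attains the best Lagrangian score at every context, so the dual inequality at
  -- that policy is the whole claim.
  refine ⟨c, hc, le_trans (le_of_eq ?_) (h (greedy (lagrangian μ W c)))⟩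
  set π : Policy m K := greedy (lagrangian μ W c) with hπ
  have hr : expReward D π = ∫ y, μ ⬝ᵥ (y.1 *ᵥ π.arms y.1) ∂D :=
    hD.isSignal_reward.integral_value_eq π
  have hv : ∀ j, expConsumption D π j = ∫ y, (fun l => W l j) ⬝ᵥ (y.1 *ᵥ π.arms y.1) ∂D :=
    fun j => (hD.isSignal_consumption j).integral_value_eq π
  have hi : ∫ y, bestScore (lagrangian μ W c) y.1 ∂D
      = expReward D π - ∑ j, c j * expConsumption D π j := by
    simp_rw [hr, hv, ← integral_const_mul]
    rw [← integral_finsetSum _ fun j _ =>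
      ((hD.isSignal_consumption j).integrable_meanValue π).const_mul (c j),
      ← integral_sub (hD.isSignal_reward.integrable_meanValue π)
      (integrable_finsetSum _ fun j _ =>
        ((hD.isSignal_consumption j).integrable_meanValue π).const_mul (c j))]
    refine integral_congr_ae (ae_of_all _ fun y => ?_)
    simp only [← dotProduct_greedy_arms, lagrangian_dotProduct]
    rfl
  rw [hi]
  simp_rw [mul_sub, Finset.sum_sub_distrib, Finset.mul_sum]
  have e : ∑ j, T * (c j * expConsumption D π j) = ∑ j, c j * (T * expConsumption D π j) :=
    Finset.sum_congr rfl fun j _ => by ring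
  have e' : ∑ j, B * c j = ∑ j, c j * B := Finset.sum_congr rfl fun j _ => by ring
  rw [e, e']
  ring

end Lagrangian

/-! ### The estimated optimum for a given sample -/

section Sample

variable {X : ℕ → Context m K} {p : ℕ → Fin K → ℝ} {r : ℕ → ℝ} {v : ℕ → Fin d → ℝ}
  {μ : Fin m → ℝ} {W : Matrix (Fin m) (Fin d) ℝ} {N : ℕ}

theorem WHat_transpose_mulVec (i : ℕ) (x : Fin m → ℝ) (j : Fin d) :
    ((WHat X p v i)ᵀ *ᵥ x) j = muHat X p (fun i => v i j) i ⬝ᵥ x := by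
  have h : (fun l => WHat X p v i l j) = muHat X p (fun i => v i j) i := by
    ext l
    simp [WHat, muHat, Matrix.mul_apply, Matrix.mulVec, dotProduct, Matrix.sum_apply,
      Matrix.vecMulVec_apply, mul_comm]
  rw [← h]
  rfl

/-- The properties of the exploration that hold almost surely. -/
structure IsRegularSample (X : ℕ → Context m K) (p : ℕ → Fin K → ℝ) (μ : Fin m → ℝ) (N : ℕ) :
    Prop where
  context_mem : ∀ i < N, ∀ l a, X i l a ∈ Set.Icc (0 : ℝ) 1
  choice_mem : ∀ i < N, p i ∈ stdSimplex ℝ (Fin K)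
  choice_max : ∀ i < N, ∀ q ∈ stdSimplex ℝ (Fin K),
    mNorm (gram X p i)⁻¹ (X i *ᵥ q) ≤ mNorm (gram X p i)⁻¹ (X i *ᵥ p i)
  mean_mem : ∀ i < N, ∀ a, (μ ᵥ* X i) a ∈ Set.Icc (0 : ℝ) 1

theorem IsRegularSample.mulVec_mem (hR : IsRegularSample X p μ N) {i : ℕ} (hi : i < N)
    (l : Fin m) : (X i *ᵥ p i) l ∈ Set.Icc (0 : ℝ) 1 := by
  have hX := hR.context_mem i hi l
  have hp := hR.choice_mem i hi
  rw [Matrix.mulVec, dotProduct]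
  refine ⟨Finset.sum_nonneg fun a _ => mul_nonneg (hX a).1 (hp.1 a), ?_⟩
  rw [← hp.2]
  exact Finset.sum_le_sum fun a _ => mul_le_of_le_one_left (hp.1 a) (hX a).2

/-- The choice of `p i` is maximal only among distributions on the arms. A policy that also uses the
no-op is first rescaled to total mass one, which can only increase its norm. -/
theorem IsRegularSample.mNorm_arms_le (hR : IsRegularSample X p μ N) {i : ℕ} (hi : i < N)
    (π : Policy m K) :
    mNorm (gram X p i)⁻¹ (X i *ᵥ π.arms (X i)) ≤ √(width X p i) := by
  change _ ≤ mNorm (gram X p i)⁻¹ (X i *ᵥ p i)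
  set q := π.arms (X i) with hq
  set s := ∑ a, q a with hs
  have hq0 : ∀ a, 0 ≤ q a := π.arms_nonneg (X i)
  have hs1 : s ≤ 1 := π.sum_arms_le (X i)
  have hs0 : 0 ≤ s := Finset.sum_nonneg fun a _ => hq0 a
  rcases hs0.eq_or_lt with h0 | h0
  · have hqz : q = 0 := by
      ext a
      exact (Finset.sum_eq_zero_iff_of_nonneg fun a _ => hq0 a).1 h0.symm a (Finset.mem_univ a)
    rw [hqz, Matrix.mulVec_zero]
    simp [mNorm]
  · have hmem : s⁻¹ • q ∈ stdSimplex ℝ (Fin K) := by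
      refine ⟨fun a => mul_nonneg (inv_nonneg.2 hs0) (hq0 a), ?_⟩
      simp only [Pi.smul_apply, smul_eq_mul, ← Finset.mul_sum]
      exact inv_mul_cancel₀ h0.ne'
    have h1 := hR.choice_max i hi _ hmem
    rw [Matrix.mulVec_smul, mNorm_smul, abs_of_pos (inv_pos.2 h0)] at h1
    have h2 : 1 ≤ s⁻¹ := (one_le_inv₀ h0).2 hs1
    exact (le_mul_of_one_le_left (mNorm_nonneg _ _) h2).trans h1

theorem IsRegularSample.abs_sum_sub_le (hR : IsRegularSample X p μ N) {θ : Fin m → ℝ} {L : ℝ}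
    (hN : 2 ≤ N) (hmN : m ^ 2 ≤ N) (hL : 16 + Real.log N ≤ L)
    (hθ : ∀ l, θ l ∈ Set.Icc (0 : ℝ) 1)
    (hS : ∀ i < N, selfNormExp X p θ r i ≤ Real.exp L) (π : Policy m K) :
    |∑ i ∈ Finset.range N, muHat X p r i ⬝ᵥ (X i *ᵥ π.arms (X i))
      - ∑ i ∈ Finset.range N, θ ⬝ᵥ (X i *ᵥ π.arms (X i))|
      ≤ 3 * (m * √(N * Real.log N * L)) := by
  rw [← Finset.sum_sub_distrib]
  exact (Finset.abs_sum_le_sum_abs _ _).trans (sum_abs_muHat_sub_le hN hmN hL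
    (fun i hi => hR.mulVec_mem hi) hθ hS fun i hi => hR.mNorm_arms_le hi π)

variable {T T₀ : ℕ} {B γ e : ℝ} {c : Fin d → ℝ}

/-- The no-op policy is admissible for the estimated optimum. -/
theorem noop_mem_values (h : 0 ≤ B + γ) :
    ∃ π : Policy m K, (∀ j, (T / T₀ : ℝ) * ∑ i ∈ Finset.range T₀,
      ((WHat X p v i)ᵀ *ᵥ (X i *ᵥ π.arms (X i))) j ≤ B + γ) ∧
      0 = (T / T₀ : ℝ) * ∑ i ∈ Finset.range T₀, muHat X p r i ⬝ᵥ (X i *ᵥ π.arms (X i)) :=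
  ⟨Policy.noop m K, fun j => by simpa [Policy.noop_arms] using h, by simp [Policy.noop_arms]⟩

theorem le_OPTHat (hmem : ∀ i < T₀, ∀ a, (μ ᵥ* X i) a ∈ Set.Icc (0 : ℝ) 1)
    (hr : ∀ π : Policy m K, |∑ i ∈ Finset.range T₀, muHat X p r i ⬝ᵥ (X i *ᵥ π.arms (X i))
      - ∑ i ∈ Finset.range T₀, μ ⬝ᵥ (X i *ᵥ π.arms (X i))| ≤ e)
    (hv : ∀ (π : Policy m K) (j : Fin d),
      |∑ i ∈ Finset.range T₀, muHat X p (fun i => v i j) i ⬝ᵥ (X i *ᵥ π.arms (X i))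
      - ∑ i ∈ Finset.range T₀, (fun l => W l j) ⬝ᵥ (X i *ᵥ π.arms (X i))| ≤ e)
    {π : Policy m K}
    (hπ : ∀ j, (T / T₀ : ℝ) * (∑ i ∈ Finset.range T₀,
      (fun l => W l j) ⬝ᵥ (X i *ᵥ π.arms (X i)) + e) ≤ B + γ) :
    (T / T₀ : ℝ) * (∑ i ∈ Finset.range T₀, μ ⬝ᵥ (X i *ᵥ π.arms (X i)) - e)
      ≤ OPTHat X p r v T T₀ B γ := by
  have hκ : (0 : ℝ) ≤ T / T₀ := by positivity
  -- The supremum is a real `sSup`, so boundedness has to be proved; it follows from the mean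
  -- rewards being at most `1`.
  have hbdd : BddAbove {val | ∃ π : Policy m K,
      (∀ j, (T / T₀ : ℝ) * ∑ i ∈ Finset.range T₀,
        ((WHat X p v i)ᵀ *ᵥ (X i *ᵥ π.arms (X i))) j ≤ B + γ) ∧
      val = (T / T₀ : ℝ) * ∑ i ∈ Finset.range T₀, muHat X p r i ⬝ᵥ (X i *ᵥ π.arms (X i))} := by
    refine ⟨(T / T₀ : ℝ) * (T₀ + e), ?_⟩
    rintro _ ⟨π', -, rfl⟩
    gcongr
    have h1 : ∑ i ∈ Finset.range T₀, μ ⬝ᵥ (X i *ᵥ π'.arms (X i))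
        ≤ ∑ _i ∈ Finset.range T₀, (1 : ℝ) :=
      Finset.sum_le_sum fun i hi => by
        rw [Matrix.dotProduct_mulVec]
        exact (dotProduct_arms_mem π' (X i) (hmem i (Finset.mem_range.1 hi))).2
    rw [Finset.sum_const, Finset.card_range, nsmul_eq_mul, mul_one] at h1
    linarith [(abs_le.1 (hr π')).2]
  refine le_trans ?_ (le_csSup hbdd ⟨π, fun j => ?_, rfl⟩)
  · gcongr
    linarith [(abs_le.1 (hr π)).1]
  · refine le_trans ?_ (hπ j)
    simp_rw [WHat_transpose_mulVec]
    gcongr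
    linarith [(abs_le.1 (hv π j)).2]

/-- Weak duality on the sample. Prices of the true problem need not be optimal here: any nonnegative
prices give an upper bound. -/
theorem OPTHat_le (hBγ : 0 ≤ B + γ) (hc : ∀ j, 0 ≤ c j)
    (hr : ∀ π : Policy m K, |∑ i ∈ Finset.range T₀, muHat X p r i ⬝ᵥ (X i *ᵥ π.arms (X i))
      - ∑ i ∈ Finset.range T₀, μ ⬝ᵥ (X i *ᵥ π.arms (X i))| ≤ e)
    (hv : ∀ (π : Policy m K) (j : Fin d),
      |∑ i ∈ Finset.range T₀, muHat X p (fun i => v i j) i ⬝ᵥ (X i *ᵥ π.arms (X i))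
      - ∑ i ∈ Finset.range T₀, (fun l => W l j) ⬝ᵥ (X i *ᵥ π.arms (X i))| ≤ e) :
    OPTHat X p r v T T₀ B γ ≤
      (T / T₀ : ℝ) * (∑ i ∈ Finset.range T₀, bestScore (lagrangian μ W c) (X i) + e)
        + (∑ j, c j) * (B + γ + (T / T₀ : ℝ) * e) := by
  have hκ : (0 : ℝ) ≤ T / T₀ := by positivity
  refine csSup_le ⟨_, noop_mem_values hBγ⟩ ?_
  rintro _ ⟨π, hπ, rfl⟩
  simp_rw [WHat_transpose_mulVec] at hπ
  set κ : ℝ := T / T₀ with hκdef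
  have h1 : ∑ i ∈ Finset.range T₀, μ ⬝ᵥ (X i *ᵥ π.arms (X i))
      ≤ ∑ i ∈ Finset.range T₀, bestScore (lagrangian μ W c) (X i)
        + ∑ j, c j * ∑ i ∈ Finset.range T₀, (fun l => W l j) ⬝ᵥ (X i *ᵥ π.arms (X i)) := by
    simp_rw [Finset.mul_sum]
    rw [Finset.sum_comm, ← Finset.sum_add_distrib]
    refine Finset.sum_le_sum fun i _ => ?_
    have := dotProduct_arms_le_bestScore (lagrangian μ W c) π (X i)
    rw [lagrangian_dotProduct] at this
    linarith
  have h2 : κ * ∑ j, c j * ∑ i ∈ Finset.range T₀, (fun l => W l j) ⬝ᵥ (X i *ᵥ π.arms (X i))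
      ≤ (∑ j, c j) * (B + γ + κ * e) := by
    rw [Finset.mul_sum, Finset.sum_mul]
    refine Finset.sum_le_sum fun j _ => ?_
    have h3 := mul_le_mul_of_nonneg_left (abs_le.1 (hv π j)).1 hκ
    have h4 := mul_le_mul_of_nonneg_left (show κ * ∑ i ∈ Finset.range T₀,
      (fun l => W l j) ⬝ᵥ (X i *ᵥ π.arms (X i)) ≤ B + γ + κ * e by linarith [hπ j]) (hc j)
    linarith
  have h5 := mul_le_mul_of_nonneg_left h1 hκ
  have h6 := mul_le_mul_of_nonneg_left (abs_le.1 (hr π)).2 hκ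
  linarith

end Sample

/-- Dual feasibility gives `s ≤ O / B`, so relaxing the budget costs a multiple of `γ * O / B`; this
produces the multiplicative form. -/
theorem one_add_div_bounds {O Oh B γ s e₁ e₂ I : ℝ} (hB : 0 < B) (hγ : 0 ≤ γ)
    (hI : 0 ≤ I) (hs : 0 ≤ s) (hdual : I + B * s ≤ O) (he₁ : e₁ ≤ 9 * γ) (he : e₁ + e₂ ≤ 9 * γ)
    (hOh : Oh ≤ I + e₂ + e₁ + s * (B + 2 * γ + e₁)) :
    (Oh + 2 * γ) / B + 1 ≤ (1 + 11 * γ / B) * (O / B + 1) := by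
  have h1 : s * (2 * γ + e₁) ≤ 11 * γ * (O / B) := by
    have h2 : s ≤ O / B := by
      rw [le_div_iff₀ hB]
      linarith
    calc s * (2 * γ + e₁) ≤ s * (11 * γ) := by gcongr; linarith
      _ ≤ O / B * (11 * γ) := by gcongr
      _ = _ := mul_comm _ _
  have h3 : Oh + 2 * γ ≤ O + 11 * γ + 11 * γ * (O / B) := by linarith
  calc (Oh + 2 * γ) / B + 1 ≤ (O + 11 * γ + 11 * γ * (O / B)) / B + 1 := by gcongr
    _ = (1 + 11 * γ / B) * (O / B + 1) := by
        field_simp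
        ring

/-! ### Sampling errors -/

section Sampling

variable {Ω : Type*} {mΩ : MeasurableSpace Ω} {P : Measure Ω}
  {D : Measure (Outcome m K d)} {T₀ : ℕ} {ℱ : Filtration ℕ mΩ}
  {Y : ℕ → Ω → Outcome m K d} {p : ℕ → Ω → Fin K → ℝ} {A : ℕ → Ω → Fin K}
  {f : Context m K → ℝ} {L : ℝ} [IsProbabilityMeasure P]

/-- For `m = 0` the permitted deviation vanishes, hence the separate assumption that `f` is then
zero. -/
theorem IsExploration.measure_sum_context_gt_le (hE : IsExploration P D T₀ ℱ Y p A)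
    (hf : Measurable f) (hf01 : ∀ᵐ y ∂D, f y.1 ∈ Set.Icc (0 : ℝ) 1)
    (hf0 : m = 0 → ∀ X, f X = 0) (hT : 2 ≤ T₀) (hL : 0 ≤ L) :
    P {ω | T₀ * ∫ y, f y.1 ∂D + m * √(T₀ * Real.log T₀ * L)
      < ∑ i ∈ Finset.range T₀, f (Y i ω).1} ≤ ENNReal.ofReal (Real.exp (-L)) := by
  rcases Nat.eq_zero_or_pos m with hm | hm
  · have hz := hf0 hm
    simp [hz, hm]
  · refine (measure_mono fun ω hω => ?_).trans
      (hE.measure_sum_gt_le (hf.comp measurable_fst) hf01 (by omega) hL)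
    have h := sqrt_half_mul_le hT hm hL
    simp only [Set.mem_ofPred_eq, Function.comp_apply] at hω ⊢
    linarith

theorem IsExploration.measure_sum_context_lt_le [IsProbabilityMeasure D]
    (hE : IsExploration P D T₀ ℱ Y p A)
    (hf : Measurable f) (hf01 : ∀ᵐ y ∂D, f y.1 ∈ Set.Icc (0 : ℝ) 1)
    (hf0 : m = 0 → ∀ X, f X = 0) (hT : 2 ≤ T₀) (hL : 0 ≤ L) :
    P {ω | ∑ i ∈ Finset.range T₀, f (Y i ω).1 + m * √(T₀ * Real.log T₀ * L)
      < T₀ * ∫ y, f y.1 ∂D} ≤ ENNReal.ofReal (Real.exp (-L)) := by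
  rcases Nat.eq_zero_or_pos m with hm | hm
  · have hz := hf0 hm
    simp [hz, hm]
  · have hfi : Integrable (fun y : Outcome m K d => f y.1) D :=
      integrable_of_mem_Icc (hf.comp measurable_fst) hf01
    have hint : ∫ y, (1 - f y.1) ∂D = 1 - ∫ y, f y.1 ∂D := by
      rw [integral_sub (integrable_const 1) hfi]
      simp
    refine (measure_mono fun ω hω => ?_).trans
      (hE.measure_sum_gt_le (f := fun y => 1 - f y.1) ((hf.comp measurable_fst).const_sub 1)
        (hf01.mono fun y hy => ⟨by linarith [hy.2], by linarith [hy.1]⟩) (by omega) hL)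
    have h := sqrt_half_mul_le hT hm hL
    simp only [Set.mem_ofPred_eq] at hω ⊢
    rw [hint, Finset.sum_sub_distrib]
    simp only [Finset.sum_const, Finset.card_range, nsmul_eq_mul, mul_one]
    linarith

end Sampling

/-! ### The good event -/

section Main

variable {Ω : Type*} {mΩ : MeasurableSpace Ω} {P : Measure Ω}
  {D : Measure (Outcome m K d)} {T T₀ : ℕ} {ℱ : Filtration ℕ mΩ}
  {Y : ℕ → Ω → Outcome m K d} {p : ℕ → Ω → Fin K → ℝ} {A : ℕ → Ω → Fin K}
  {μ : Fin m → ℝ} {W : Matrix (Fin m) (Fin d) ℝ} {B γ L : ℝ}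

theorem IsExploration.ae_isRegularSample (hE : IsExploration P D T₀ ℱ Y p A)
    (hD : IsInstance D μ W) :
    ∀ᵐ ω ∂P, IsRegularSample (fun i => (Y i ω).1) (fun i => p i ω) μ T₀ := by
  have := hD.prob
  have h : ∀ᵐ ω ∂P, ∀ i, i < T₀ → (∀ l a, (Y i ω).1 l a ∈ Set.Icc (0 : ℝ) 1) ∧
      p i ω ∈ stdSimplex ℝ (Fin K) ∧ (∀ q ∈ stdSimplex ℝ (Fin K),
      mNorm (gram (fun i => (Y i ω).1) (fun i => p i ω) i)⁻¹ ((Y i ω).1 *ᵥ q) ≤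
      mNorm (gram (fun i => (Y i ω).1) (fun i => p i ω) i)⁻¹ ((Y i ω).1 *ᵥ p i ω)) ∧
      ∀ a, (μ ᵥ* (Y i ω).1) a ∈ Set.Icc (0 : ℝ) 1 := by
    refine ae_all_iff.2 fun i => ?_
    by_cases hi : i < T₀
    · filter_upwards [hE.ae_outcome hi hD.context_mem, hE.choice_mem i hi, hE.choice_max i hi,
        hE.ae_outcome hi hD.isSignal_reward.mean_mem] with ω h1 h2 h3 h4 _
      exact ⟨h1, h2, h3, h4⟩
    · exact ae_of_all _ fun ω h => absurd h hi
  filter_upwards [h] with ω hω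
  exact ⟨fun i hi => (hω i hi).1, fun i hi => (hω i hi).2.1, fun i hi => (hω i hi).2.2.1,
    fun i hi => (hω i hi).2.2.2⟩

/-- The self-normalized process of a signal `h` stays below `exp L` during the exploration. -/
def NoiseBounded (Y : ℕ → Ω → Outcome m K d) (p : ℕ → Ω → Fin K → ℝ) (A : ℕ → Ω → Fin K) (T₀ : ℕ)
    (L : ℝ) (h : Outcome m K d → Fin K → ℝ) (θ : Fin m → ℝ) (ω : Ω) : Prop :=
  ∀ t < T₀, selfNormExp (fun i => (Y i ω).1) (fun i => p i ω) θ
    (fun i => h (Y i ω) (A i ω)) t ≤ Real.exp L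

/-- All the estimates used in the exploration phase are accurate. -/
def AccurateEstimates (Y : ℕ → Ω → Outcome m K d) (p : ℕ → Ω → Fin K → ℝ) (A : ℕ → Ω → Fin K)
    (μ : Fin m → ℝ) (W : Matrix (Fin m) (Fin d) ℝ) (T₀ : ℕ) (L : ℝ) (ω : Ω) : Prop :=
  IsRegularSample (fun i => (Y i ω).1) (fun i => p i ω) μ T₀ ∧
  NoiseBounded Y p A T₀ L (fun y => y.2.1) μ ω ∧
  ∀ j, NoiseBounded Y p A T₀ L (fun y a => y.2.2 j a) (fun l => W l j) ω

theorem IsExploration.measure_not_accurateEstimates_le [IsProbabilityMeasure P]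
    (hE : IsExploration P D T₀ ℱ Y p A) (hD : IsInstance D μ W) (L : ℝ) :
    P {ω | ¬ AccurateEstimates Y p A μ W T₀ L ω}
      ≤ (d + 1) * (T₀ * ENNReal.ofReal (Real.exp (-L))) := by
  have := hD.prob
  set b : ENNReal := T₀ * ENNReal.ofReal (Real.exp (-L)) with hb
  have hN : ∀ (h : Outcome m K d → Fin K → ℝ) (θ : Fin m → ℝ), IsSignal D h θ →
      P {ω | ¬ NoiseBounded Y p A T₀ L h θ ω} ≤ b := by
    intro h θ hs
    refine (measure_mono fun ω hω => ?_).trans (hE.measure_selfNormExp_gt_le hs L)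
    simpa [NoiseBounded] using hω
  have hsub : {ω | ¬ AccurateEstimates Y p A μ W T₀ L ω} ⊆
      ({ω | ¬ IsRegularSample (fun i => (Y i ω).1) (fun i => p i ω) μ T₀} ∪
        {ω | ¬ NoiseBounded Y p A T₀ L (fun y => y.2.1) μ ω}) ∪
        ⋃ j, {ω | ¬ NoiseBounded Y p A T₀ L (fun y a => y.2.2 j a) (fun l => W l j) ω} := by
    intro ω hω
    by_contra hcon
    simp only [Set.mem_union, Set.mem_iUnion, Set.mem_ofPred_eq, not_or, not_not, not_exists]
      at hcon
    exact hω ⟨hcon.1.1, hcon.1.2, hcon.2⟩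
  calc P {ω | ¬ AccurateEstimates Y p A μ W T₀ L ω}
      ≤ (0 + b) + ∑ _j : Fin d, b := by
        refine (measure_mono hsub).trans ((measure_union_le _ _).trans (add_le_add
          ((measure_union_le _ _).trans (add_le_add (le_of_eq ?_) ?_))
          ((measure_iUnion_fintype_le _ _).trans (Finset.sum_le_sum fun j _ => ?_))))
        · exact ae_iff.1 (hE.ae_isRegularSample hD)
        · exact hN _ _ hD.isSignal_reward
        · exact hN _ _ (hD.isSignal_consumption j)
    _ = (d + 1) * b := by
        simp
        ring

theorem AccurateEstimates.abs_reward_sub_le {ω : Ω} (hA : AccurateEstimates Y p A μ W T₀ L ω)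
    (hD : IsInstance D μ W) (hT₀ : 2 ≤ T₀) (hm : m ^ 2 ≤ T₀) (hL : 16 + Real.log T₀ ≤ L)
    (π : Policy m K) :
    |∑ i ∈ Finset.range T₀, muHat (fun i => (Y i ω).1) (fun i => p i ω)
        (fun i => (Y i ω).2.1 (A i ω)) i ⬝ᵥ ((Y i ω).1 *ᵥ π.arms (Y i ω).1)
      - ∑ i ∈ Finset.range T₀, μ ⬝ᵥ ((Y i ω).1 *ᵥ π.arms (Y i ω).1)|
      ≤ 3 * (m * √(T₀ * Real.log T₀ * L)) :=
  hA.1.abs_sum_sub_le hT₀ hm hL hD.mu_mem hA.2.1 π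

theorem AccurateEstimates.abs_consumption_sub_le {ω : Ω}
    (hA : AccurateEstimates Y p A μ W T₀ L ω)
    (hD : IsInstance D μ W) (hT₀ : 2 ≤ T₀) (hm : m ^ 2 ≤ T₀) (hL : 16 + Real.log T₀ ≤ L)
    (π : Policy m K) (j : Fin d) :
    |∑ i ∈ Finset.range T₀, muHat (fun i => (Y i ω).1) (fun i => p i ω)
        (fun i => (Y i ω).2.2 j (A i ω)) i ⬝ᵥ ((Y i ω).1 *ᵥ π.arms (Y i ω).1)
      - ∑ i ∈ Finset.range T₀, (fun l => W l j) ⬝ᵥ ((Y i ω).1 *ᵥ π.arms (Y i ω).1)|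
      ≤ 3 * (m * √(T₀ * Real.log T₀ * L)) :=
  hA.1.abs_sum_sub_le hT₀ hm hL (fun l => hD.W_mem l j) (hA.2.2 j) π

/-- A fixed feasible policy is unlikely to beat the estimated optimum. -/
theorem IsExploration.measure_OPTHat_lt_le [IsProbabilityMeasure P]
    (hE : IsExploration P D T₀ ℱ Y p A) (hD : IsInstance D μ W) (hT₀ : 2 ≤ T₀) (hm : m ^ 2 ≤ T₀)
    (hL : 16 + Real.log T₀ ≤ L) (hγ : (T / T₀ : ℝ) * (2 * m * √(T₀ * Real.log T₀ * L)) ≤ γ)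
    {π : Policy m K} (hπ : ∀ j, T * expConsumption D π j ≤ B) :
    P {ω | AccurateEstimates Y p A μ W T₀ L ω ∧
      OPTHat (fun i => (Y i ω).1) (fun i => p i ω) (fun i => (Y i ω).2.1 (A i ω))
        (fun i j => (Y i ω).2.2 j (A i ω)) T T₀ B (2 * γ) + 2 * γ < T * expReward D π}
      ≤ (d + 1) * ENNReal.ofReal (Real.exp (-L)) := by
  have := hD.prob
  have hT₀' : (0 : ℝ) < T₀ := by exact_mod_cast (by omega : 0 < T₀)
  have hL0 : 0 ≤ L := by
    have := Real.log_natCast_nonneg T₀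
    linarith
  set R := √(T₀ * Real.log T₀ * L) with hR
  set κ : ℝ := T / T₀ with hκdef
  have hκ : 0 ≤ κ := by positivity
  have hκT : κ * T₀ = T := div_mul_cancel₀ _ hT₀'.ne'
  have hrew : expReward D π = ∫ y, μ ⬝ᵥ (y.1 *ᵥ π.arms y.1) ∂D :=
    hD.isSignal_reward.integral_value_eq π
  have hcon : ∀ j, expConsumption D π j = ∫ y, (fun l => W l j) ⬝ᵥ (y.1 *ᵥ π.arms y.1) ∂D :=
    fun j => (hD.isSignal_consumption j).integral_value_eq π
  have hzero : ∀ θ : Fin m → ℝ, m = 0 → ∀ X : Context m K, θ ⬝ᵥ (X *ᵥ π.arms X) = 0 := by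
    rintro θ rfl X
    simp [dotProduct]
  have hsub : {ω | AccurateEstimates Y p A μ W T₀ L ω ∧
      OPTHat (fun i => (Y i ω).1) (fun i => p i ω) (fun i => (Y i ω).2.1 (A i ω))
        (fun i j => (Y i ω).2.2 j (A i ω)) T T₀ B (2 * γ) + 2 * γ < T * expReward D π} ⊆
      {ω | ∑ i ∈ Finset.range T₀, μ ⬝ᵥ ((Y i ω).1 *ᵥ π.arms (Y i ω).1) + m * R
        < T₀ * ∫ y, μ ⬝ᵥ (y.1 *ᵥ π.arms y.1) ∂D} ∪
      ⋃ j, {ω | T₀ * ∫ y, (fun l => W l j) ⬝ᵥ (y.1 *ᵥ π.arms y.1) ∂D + m * R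
        < ∑ i ∈ Finset.range T₀, (fun l => W l j) ⬝ᵥ ((Y i ω).1 *ᵥ π.arms (Y i ω).1)} := by
    rintro ω ⟨hA, hlt⟩
    by_contra hcontra
    simp only [Set.mem_union, Set.mem_iUnion, Set.mem_ofPred_eq, not_or, not_exists, not_lt]
      at hcontra
    obtain ⟨h1, h2⟩ := hcontra
    -- Regression costs `3 * m * R` and sampling `m * R`; scaled by `κ` they sum to at most `2 * γ`,
    -- both in each constraint and in the value.
    have h3 := le_OPTHat (T := T) (B := B) (γ := 2 * γ) hA.1.mean_mem
      (hA.abs_reward_sub_le hD hT₀ hm hL) (hA.abs_consumption_sub_le hD hT₀ hm hL) (π := π)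
      fun j => by
        have h4 := mul_le_mul_of_nonneg_left (h2 j) hκ
        have h5 := hπ j
        rw [hcon, ← hκT] at h5
        linarith
    have h4 := mul_le_mul_of_nonneg_left h1 hκ
    rw [hrew, ← hκT] at hlt
    linarith
  calc _ ≤ ENNReal.ofReal (Real.exp (-L)) + ∑ _j : Fin d, ENNReal.ofReal (Real.exp (-L)) := by
        refine (measure_mono hsub).trans ((measure_union_le _ _).trans (add_le_add ?_
          ((measure_iUnion_fintype_le _ _).trans (Finset.sum_le_sum fun j _ => ?_))))
        · exact hE.measure_sum_context_lt_le (measurable_meanValue μ π)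
            (hD.isSignal_reward.meanValue_mem π) (hzero μ) hT₀ hL0
        · exact hE.measure_sum_context_gt_le (measurable_meanValue (fun l => W l j) π)
            ((hD.isSignal_consumption j).meanValue_mem π) (hzero _) hT₀ hL0
    _ = (d + 1) * ENNReal.ofReal (Real.exp (-L)) := by
        simp
        ring

/-- The supremum `OPT` need not be attained. Policies within `1 / (n + 1)` of it give increasing
events with a bound independent of `n`, and continuity of the measure from below passes to the
limit. -/
theorem IsExploration.measure_OPTHat_lt_OPT_le [IsProbabilityMeasure P]
    (hE : IsExploration P D T₀ ℱ Y p A) (hD : IsInstance D μ W) (hT₀ : 2 ≤ T₀) (hm : m ^ 2 ≤ T₀)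
    (hB : 0 < B)
    (hL : 16 + Real.log T₀ ≤ L) (hγ : (T / T₀ : ℝ) * (2 * m * √(T₀ * Real.log T₀ * L)) ≤ γ) :
    P {ω | AccurateEstimates Y p A μ W T₀ L ω ∧
      OPTHat (fun i => (Y i ω).1) (fun i => p i ω) (fun i => (Y i ω).2.1 (A i ω))
        (fun i j => (Y i ω).2.2 j (A i ω)) T T₀ B (2 * γ) + 2 * γ < OPT D T B}
      ≤ (d + 1) * ENNReal.ofReal (Real.exp (-L)) := by
  set O : Ω → ℝ := fun ω =>
    OPTHat (fun i => (Y i ω).1) (fun i => p i ω) (fun i => (Y i ω).2.1 (A i ω))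
      (fun i j => (Y i ω).2.2 j (A i ω)) T T₀ B (2 * γ) + 2 * γ with hO
  set E : ℕ → Set Ω := fun n =>
    {ω | AccurateEstimates Y p A μ W T₀ L ω ∧ O ω < OPT D T B - 1 / (n + 1)} with hEdef
  have hsub : {ω | AccurateEstimates Y p A μ W T₀ L ω ∧ O ω < OPT D T B} ⊆ ⋃ n, E n := by
    rintro ω ⟨hA, hlt⟩
    obtain ⟨n, hn⟩ := exists_nat_one_div_lt (sub_pos.2 hlt)
    exact Set.mem_iUnion.2 ⟨n, hA, by linarith⟩
  have hmono : Monotone E := by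
    rintro n n' hn ω ⟨hA, hlt⟩
    have : (1 : ℝ) / (n' + 1) ≤ 1 / (n + 1) := Nat.one_div_le_one_div hn
    exact ⟨hA, by linarith⟩
  refine (measure_mono hsub).trans ?_
  rw [hmono.measure_iUnion]
  refine iSup_le fun n => ?_
  have hpos : (0 : ℝ) < 1 / (n + 1) := Nat.one_div_pos_of_nat
  obtain ⟨π, hπ, hgt⟩ := exists_policy_gt (D := D) (T := T) hB.le
    (show OPT D T B - 1 / (n + 1) < OPT D T B by linarith)
  refine (measure_mono ?_).trans (hE.measure_OPTHat_lt_le hD hT₀ hm hL hγ hπ)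
  rintro ω ⟨hA, hlt⟩
  exact ⟨hA, hlt.trans hgt⟩

/-- The estimated optimum is unlikely to exceed the true one by much. -/
theorem IsExploration.measure_Z_gt_le [IsProbabilityMeasure P]
    (hE : IsExploration P D T₀ ℱ Y p A) (hD : IsInstance D μ W) (hT₀ : 2 ≤ T₀) (hm : m ^ 2 ≤ T₀)
    (hB : 0 < B)
    (hL : 16 + Real.log T₀ ≤ L) (hγ : (T / T₀ : ℝ) * (2 * m * √(T₀ * Real.log T₀ * L)) ≤ γ) :
    P {ω | AccurateEstimates Y p A μ W T₀ L ω ∧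
      (1 + 11 * γ / B) * (OPT D T B / B + 1) < Z Y p A T T₀ B γ ω}
      ≤ ENNReal.ofReal (Real.exp (-L)) := by
  have := hD.prob
  have hT₀' : (0 : ℝ) < T₀ := by exact_mod_cast (by omega : 0 < T₀)
  have hL0 : 0 ≤ L := by
    have := Real.log_natCast_nonneg T₀
    linarith
  obtain ⟨c, hc, hdual⟩ := hD.exists_prices_bestScore T hB
  refine (measure_mono ?_).trans (hE.measure_sum_context_gt_le
    (measurable_bestScore (lagrangian μ W c)) (hD.bestScore_mem hc) ?_ hT₀ hL0)
  · rintro ω ⟨hA, hlt⟩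
    by_contra hcontra
    simp only [Set.mem_ofPred_eq, not_lt] at hcontra
    refine absurd hlt (not_lt.2 ?_)
    set R := √(T₀ * Real.log T₀ * L) with hR
    set κ : ℝ := T / T₀ with hκdef
    have hκ : 0 ≤ κ := by positivity
    have hκT : κ * T₀ = T := div_mul_cancel₀ _ hT₀'.ne'
    have hκR : 0 ≤ κ * (m * R) := by positivity
    have hγ0 : 0 ≤ γ := by linarith
    have hle := OPTHat_le (T := T) (by positivity : 0 ≤ B + 2 * γ) hc
      (hA.abs_reward_sub_le hD hT₀ hm hL) (hA.abs_consumption_sub_le hD hT₀ hm hL)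
    have h1 := mul_le_mul_of_nonneg_left hcontra hκ
    rw [mul_add, ← mul_assoc, hκT] at h1
    -- The errors are in fact at most `1.5 * γ` and `0.5 * γ`, well within the required `9 * γ`.
    refine one_add_div_bounds hB hγ0
      (mul_nonneg (Nat.cast_nonneg T) (integral_nonneg fun y => bestScore_nonneg _ _))
      (Finset.sum_nonneg fun j _ => hc j) hdual (e₁ := κ * (3 * (m * R))) (e₂ := κ * (m * R))
      (by linarith) (by linarith) ?_
    linarith
  · rintro rfl X
    obtain ⟨o, ho⟩ := exists_score_eq (lagrangian μ W c) X
    rw [← ho]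
    cases o <;> simp [score]

end Main

end LinCBwK

end

/-! ### The main theorem: union bound and choice of the constant -/

theorem mainTheorem5 :
    ∃ C : ℝ, 0 < C ∧
      ∀ (m K d T T₀ : ℕ) (B δ γ : ℝ)
        (D : Measure (LinCBwK.Outcome m K d)) (μ : Fin m → ℝ) (W : Matrix (Fin m) (Fin d) ℝ)
        (Ω : Type*) (mΩ : MeasurableSpace Ω) (P : Measure Ω) (ℱ : Filtration ℕ mΩ)
        (Y : ℕ → Ω → LinCBwK.Outcome m K d) (p : ℕ → Ω → Fin K → ℝ) (A : ℕ → Ω → Fin K),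
        1 ≤ d → 2 ≤ T₀ → m ^ 2 ≤ T₀ → T₀ ≤ T → 0 < B → 0 < δ → δ < 1 →
        (T / T₀ : ℝ) * (2 * m * √(T₀ * Real.log T₀ * Real.log (T₀ * d / δ))) ≤ γ →
        IsProbabilityMeasure P →
        LinCBwK.IsInstance D μ W →
        LinCBwK.IsExploration P D T₀ ℱ Y p A →
        P {ω | ¬ (LinCBwK.OPT D T B / B + 1 ≤ LinCBwK.Z Y p A T T₀ B γ ω ∧
            LinCBwK.Z Y p A T T₀ B γ ω ≤ (1 + 11 * γ / B) * (LinCBwK.OPT D T B / B + 1) ∧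
            (γ ≤ B → LinCBwK.Z Y p A T T₀ B γ ω ≤ 12 * (LinCBwK.OPT D T B / B + 1)))}
          ≤ ENNReal.ofReal (C * δ) := by
  refine ⟨Real.exp 16, Real.exp_pos 16, ?_⟩
  intro m K d T T₀ B δ γ D μ W Ω mΩ P ℱ Y p A hd hT₀ hm _ hB hδ _ hγ _ hD hE
  -- For such `δ` the claimed bound is at least `1`. Otherwise `16 + log T₀ ≤ L`, which the
  -- regression bound needs.
  rcases le_or_gt (Real.exp (-16)) δ with hδ16 | hδ16
  · refine prob_le_one.trans ?_
    rw [← ENNReal.ofReal_one]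
    refine ENNReal.ofReal_le_ofReal ?_
    calc (1 : ℝ) = Real.exp 16 * Real.exp (-16) := by rw [← Real.exp_add]; simp
      _ ≤ Real.exp 16 * δ := by gcongr
  have hT₀' : (2 : ℝ) ≤ T₀ := by exact_mod_cast hT₀
  have hd' : (1 : ℝ) ≤ d := by exact_mod_cast hd
  set L := Real.log (T₀ * d / δ) with hLdef
  have hL : 16 + Real.log T₀ ≤ L := by
    rw [hLdef, Real.le_log_iff_exp_le (by positivity), Real.exp_add, Real.exp_log (by linarith),
      le_div_iff₀ hδ]
    calc Real.exp 16 * T₀ * δ ≤ Real.exp 16 * T₀ * Real.exp (-16) := by gcongr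
      _ = Real.exp 16 * Real.exp (-16) * T₀ := by ring
      _ = T₀ := by rw [← Real.exp_add]; simp
      _ ≤ T₀ * d := le_mul_of_one_le_right (by linarith) hd'
  have hexp : Real.exp (-L) = δ / (T₀ * d) := by
    rw [Real.exp_neg, hLdef, Real.exp_log (by positivity), inv_div]
  have hO := hD.OPT_nonneg (T := T) hB.le
  have hsub : {ω | ¬ (LinCBwK.OPT D T B / B + 1 ≤ LinCBwK.Z Y p A T T₀ B γ ω ∧
      LinCBwK.Z Y p A T T₀ B γ ω ≤ (1 + 11 * γ / B) * (LinCBwK.OPT D T B / B + 1) ∧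
      (γ ≤ B → LinCBwK.Z Y p A T T₀ B γ ω ≤ 12 * (LinCBwK.OPT D T B / B + 1)))} ⊆
      ({ω | ¬ LinCBwK.AccurateEstimates Y p A μ W T₀ L ω} ∪
      {ω | LinCBwK.AccurateEstimates Y p A μ W T₀ L ω ∧
        LinCBwK.OPTHat (fun i => (Y i ω).1) (fun i => p i ω) (fun i => (Y i ω).2.1 (A i ω))
          (fun i j => (Y i ω).2.2 j (A i ω)) T T₀ B (2 * γ) + 2 * γ < LinCBwK.OPT D T B}) ∪
      {ω | LinCBwK.AccurateEstimates Y p A μ W T₀ L ω ∧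
        (1 + 11 * γ / B) * (LinCBwK.OPT D T B / B + 1) < LinCBwK.Z Y p A T T₀ B γ ω} := by
    intro ω hω
    by_contra hcon
    simp only [Set.mem_union, Set.mem_ofPred_eq, not_or, not_not, not_and, not_lt] at hcon
    obtain ⟨⟨hA, h1⟩, h2⟩ := hcon
    have h2 := h2 hA
    refine hω ⟨?_, h2, fun hγB => h2.trans ?_⟩
    · have := h1 hA
      unfold LinCBwK.Z
      gcongr
    · have h3 : γ / B ≤ 1 := (div_le_one hB).2 hγB
      gcongr
      rw [mul_div_assoc]
      linarith
  -- Since `exp (-L) = δ / (T₀ * d)`, the left side expands into five terms, each at most `δ`.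
  have hcard : (d + 1 : ℝ) * (T₀ * Real.exp (-L)) + (d + 1) * Real.exp (-L) + Real.exp (-L)
      ≤ Real.exp 16 * δ := by
    have h16 := Real.add_one_le_exp (16 : ℝ)
    have h1 : (d : ℝ) * (T₀ * Real.exp (-L)) = δ := by
      rw [hexp]
      field_simp
    have h2 : 0 < Real.exp (-L) := Real.exp_pos _
    have h3 : Real.exp (-L) ≤ T₀ * Real.exp (-L) := le_mul_of_one_le_left h2.le (by linarith)
    have h4 : T₀ * Real.exp (-L) ≤ d * (T₀ * Real.exp (-L)) :=
      le_mul_of_one_le_left (by positivity) hd'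
    have h5 : (d : ℝ) * Real.exp (-L) ≤ d * (T₀ * Real.exp (-L)) := by gcongr
    nlinarith
  refine (measure_mono hsub).trans ((measure_union_le _ _).trans ((add_le_add
    ((measure_union_le _ _).trans (add_le_add (hE.measure_not_accurateEstimates_le hD L)
      (hE.measure_OPTHat_lt_OPT_le hD hT₀ hm hB hL hγ)))
    (hE.measure_Z_gt_le hD hT₀ hm hB hL hγ)).trans ?_))
  refine le_trans (le_of_eq ?_) (ENNReal.ofReal_le_ofReal hcard)
  rw [ENNReal.ofReal_add (by positivity) (by positivity),
    ENNReal.ofReal_add (by positivity) (by positivity), ENNReal.ofReal_mul (by positivity),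
    ENNReal.ofReal_mul (by positivity), ENNReal.ofReal_mul (by positivity),
    ENNReal.ofReal_add (by positivity) (by positivity)]
  simp
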